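/- Let $1<p<q$. For $\omega\ge 0$ let $\phi_\omega$ be the ground state of $$-\phi''+\omega\phi+|\phi|^{p-1}\phi-|\phi|^{q-1}\phi=0\quad\text{on }\mathbb{R},$$ that is, the unique $C^2$ solution which is positive, even, strictly decreasing on $[0,\infty)$, and tends to $0$ at infinity. For $\omega>0$ put $M(\omega)=\tfrac12\|\phi_\omega\|_{L^2(\mathbb{R})}^2$ and $\eta_\omega(x)=\partial_\omega\phi_\omega(x)$, and put $$\eta_0(x)=\lim_{\omega\downarrow0}\eta_\omega(x)\quad(x\in\mathbb{R}),\qquad M'(0)=\lim_{\omega\downarrow0}M'(\omega)\in[-\infty,\infty].$$ All these objects are well defined: $\phi_\omega$ exists and is unique for every $\omega\ge0$; for every $\omega>0$ one has $\phi_\omega\in L^2(\mathbb{R})$, and $M$ and $\omega\mapsto\phi_\omega(x)$ (for each $x\in\mathbb{R}$) are differentiable at $\omega$; the limit $\eta_0(x)$ exists and is finite for every $x\in\mathbb{R}$; and the limit $M'(0)$ exists. Moreover: (i) If $p<7/3$, then $\phi_0\eta_0$ is integrable over $\mathbb{R}$ and $$M'(0)=\int_{\mathbb{R}}\phi_0\eta_0\,dx.$$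 (ii) If $p\ge 7/3$, then $M'(0)=-\infty$ and $\int_{\mathbb{R}}\phi_0\eta_0\,dx=-\infty$, the latter meaning that the positive part of $\phi_0\eta_0$ has finite integral and the negative part has infinite integral. -/

import Mathlib

open Filter Topology MeasureTheory

namespace DoublePower

/-- `φ` is a ground state of `-φ'' + ω φ + |φ|^(p-1) φ - |φ|^(q-1) φ = 0` on the real line: a
classical solution which is positive, even, decreasing in `|x|`, and vanishes at infinity. -/
structure IsGroundState (p q ω : ℝ) (φ : ℝ → ℝ) : Prop where
  contDiff : ContDiff ℝ 2 φ
  equation : ∀ x, -deriv (deriv φ) x + ω * φ x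
    + |φ x| ^ (p - 1) * φ x - |φ x| ^ (q - 1) * φ x = 0
  pos : ∀ x, 0 < φ x
  even : ∀ x, φ (-x) = φ x
  decreasing : StrictAntiOn φ (Set.Ici 0)
  tendsto_zero : Tendsto φ (cocompact ℝ) (𝓝 0)

/-- `φ_ω`, the ground state of frequency `ω` (for `ω ≥ 0` it exists and is unique, which is part
of the theorem). -/
noncomputable def groundState (p q ω : ℝ) : ℝ → ℝ :=
  Classical.epsilon (IsGroundState p q ω)

/-- `M(ω) = ½ ‖φ_ω‖²` with the `L²` norm. -/
noncomputable def mass (p q ω : ℝ) : ℝ :=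
  1 / 2 * ∫ x : ℝ, groundState p q ω x ^ 2

/-- `η_ω(x) = ∂_ω φ_ω(x)`, for `ω > 0`. -/
noncomputable def eta (p q ω x : ℝ) : ℝ :=
  deriv (fun w : ℝ => groundState p q w x) ω

/-- `η_0(x) = lim_{ω ↓ 0} η_ω(x)`. -/
noncomputable def etaZero (p q x : ℝ) : ℝ :=
  limUnder (𝓝[>] (0 : ℝ)) (fun ω : ℝ => eta p q ω x)

/-- The integral of `f` over the real line exists in the extended sense and equals `-∞`: the
positive part of `f` has finite integral and the negative part has infinite integral. -/
def IntegralEqNegInfinity (f : ℝ → ℝ) : Prop :=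
  AEStronglyMeasurable f volume ∧
    ∫⁻ x, ENNReal.ofReal (f x) < ⊤ ∧ ∫⁻ x, ENNReal.ofReal (-f x) = ⊤

end DoublePower

namespace DoublePower

/-! Put `β = 2/(p-1)`, `r = (q-p)/(p-1)` and substitute `φ = a z^(-β)` in the zero-energy first
integral `φ'² = φ² (ω + 2/(p+1) φ^(p-1) - 2/(q+1) φ^(q-1))`. For suitable `a`, `κ` and `σ` it
becomes `z'² = κ² speedSq r σ z`, with `z = 1` at the origin, and `σ = 0` exactly when `ω = 0`.
Hence the ground state is `a V(κ|x|)^(-β)`, where `V` inverts the travel time `T_σ(z) = ∫_1^z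
slowness`. This gives existence and uniqueness together (`IsScaling.isGroundState`,
`IsScaling.eq_of_isGroundState`). The amplitude and the length scale are explicit powers of `1 + σ`,
and `ω = c σ (1+σ)^(1/r)` is an increasing bijection of `[0, ∞)`, so everything can be
differentiated in `σ`.

With `m = 2β`, the substitution `y = T_σ(z)` turns the mass into a constant times
`(1+σ)^((m-1)/(2r)) I(σ)`, where `I(σ) = ∫_1^∞ z^(-m) slowness r σ z dz`. At `σ = 0` the function
`slownessVar = -∂_σ slowness` grows like `z²/2`, so `I'(0)` is finite exactly when `m > 3`, that is
`p < 7/3`. For `m ≤ 3` the integral of `z^(-m) slownessVar` diverges at least logarithmically as `σ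
↓ 0`, and this forces `M' → -∞`.

For `η_0`, implicit differentiation of `T_σ(V) = y` (`hasDerivAt_profile_comp`) expresses `φ_0 η_0`
through the height `z`, the travel time and its variation (`limitIntegrand`). Changing variables to
`z` cancels the speed and leaves integrals of `z^(-m-1) ∫_1^z f`. Tonelli evaluates each as `m⁻¹ ∫
t^(-m) f`. For `m > 3` the sum is exactly the limit of `M'`. For `m ≤ 3` the same identity, read as
an equivalence of integrability, makes the negative part infinite, while monotonicity of the speed
controls the positive part. -/

/-- The square of the speed of the normalised profile at height `z`. -/
noncomputable def speedSq (r σ z : ℝ) : ℝ :=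
  σ * (z ^ 2 - z ^ (-(2 * r))) + (1 - z ^ (-(2 * r)))

/-- The reciprocal speed of the normalised profile at height `z`. -/
noncomputable def slowness (r σ z : ℝ) : ℝ := (√(speedSq r σ z))⁻¹

/-- Minus the derivative of `slowness r σ z` in `σ`. -/
noncomputable def slownessVar (r σ z : ℝ) : ℝ :=
  (z ^ 2 - z ^ (-(2 * r))) / 2 * slowness r σ z ^ 3

/-! ### Pointwise bounds on the slowness and its variation in `σ` -/

section Bounds

variable {r σ z : ℝ}

lemma weight_pos (hz : 1 ≤ z) : 0 < z ^ (-(2 * r)) := Real.rpow_pos_of_pos (by linarith) _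

lemma weight_le_one (hr : 0 < r) (hz : 1 ≤ z) : z ^ (-(2 * r)) ≤ 1 :=
  Real.rpow_le_one_of_one_le_of_nonpos hz (by linarith)

lemma weight_lt_one (hr : 0 < r) (hz : 1 < z) : z ^ (-(2 * r)) < 1 :=
  Real.rpow_lt_one_of_one_lt_of_neg hz (by linarith)

lemma speedSq_one : speedSq r σ 1 = 0 := by simp [speedSq]

lemma speedSq_zero : speedSq r 0 z = 1 - z ^ (-(2 * r)) := by simp [speedSq]

lemma sq_sub_weight_nonneg (hr : 0 < r) (hz : 1 ≤ z) : 0 ≤ z ^ 2 - z ^ (-(2 * r)) := by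
  nlinarith [weight_le_one hr hz]

lemma speedSq_mono (hr : 0 < r) (hz : 1 ≤ z) : Monotone fun σ => speedSq r σ z := by
  intro a b hab
  have := mul_le_mul_of_nonneg_right hab (sq_sub_weight_nonneg hr hz)
  simp only [speedSq]
  linarith

lemma speedSq_nonneg (hr : 0 < r) (hσ : 0 ≤ σ) (hz : 1 ≤ z) : 0 ≤ speedSq r σ z := by
  have := speedSq_mono hr hz hσ
  have h1 := weight_le_one hr hz
  simp only [speedSq_zero] at this
  linarith

lemma speedSq_pos (hr : 0 < r) (hσ : 0 ≤ σ) (hz : 1 < z) : 0 < speedSq r σ z := by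
  have := speedSq_mono hr hz.le hσ
  have h1 := weight_lt_one hr hz
  simp only [speedSq_zero] at this
  linarith

lemma speedSq_strictMonoOn (hr : 0 < r) (hσ : 0 ≤ σ) :
    StrictMonoOn (speedSq r σ) (Set.Ioi 0) := by
  intro x hx y hy hxy
  have hx : (0 : ℝ) < x := hx
  have h1 : y ^ (-(2 * r)) < x ^ (-(2 * r)) :=
    Real.rpow_lt_rpow_of_neg hx hxy (by linarith)
  have h2 : x ^ 2 ≤ y ^ 2 := by gcongr
  have := mul_le_mul_of_nonneg_left (sub_le_sub h2 h1.le) hσ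
  simp only [speedSq]
  linarith

lemma speedSq_le (hσ : 0 ≤ σ) (hz : 1 ≤ z) : speedSq r σ z ≤ (1 + σ) * z ^ 2 := by
  have := weight_pos (r := r) hz
  simp only [speedSq]
  nlinarith [mul_nonneg hσ this.le]

lemma speedSq_le_add (hσ : 0 ≤ σ) (hz : 1 ≤ z) : speedSq r σ z ≤ 1 + σ * z ^ 2 := by
  have := weight_pos (r := r) hz
  simp only [speedSq]
  nlinarith [mul_nonneg hσ this.le]

lemma le_speedSq (hr : 0 < r) (hσ : 0 ≤ σ) (hz : 1 ≤ z) :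
    σ * z ^ 2 * speedSq r 0 z ≤ speedSq r σ z := by
  have h0 := weight_pos (r := r) hz
  have h1 := weight_le_one hr hz
  rw [speedSq_zero, speedSq]
  have : z ^ 2 * (1 - z ^ (-(2 * r))) ≤ z ^ 2 - z ^ (-(2 * r)) := by
    nlinarith [mul_nonneg h0.le (show (0:ℝ) ≤ z ^ 2 - 1 by nlinarith)]
  nlinarith [mul_le_mul_of_nonneg_left this hσ]

/-- Both sides vanish to first order at `z = 1`. This comparison is what tames the cube of the
slowness in `slownessVar`: one factor `slowness²` is absorbed by the vanishing numerator. -/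
lemma sq_sub_weight_le (hr : 0 < r) (hz : 1 ≤ z) :
    z ^ 2 - z ^ (-(2 * r)) ≤ (2 + r⁻¹) * z ^ 2 * speedSq r 0 z := by
  have hz0 : 0 < z := by linarith
  have h0 := weight_pos (r := r) hz
  have h1 := weight_le_one hr hz
  have hri : 0 < r⁻¹ := by positivity
  set t : ℝ := (z ^ 2)⁻¹ with ht
  have htpos : 0 < t := by positivity
  have hzt : z ^ 2 * t = 1 := by rw [ht]; field_simp
  have hz2 : 1 ≤ z ^ 2 := by nlinarith
  have htle : t ≤ 1 := by nlinarith
  have hW : z ^ (-(2 * r)) = t ^ r := by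
    rw [ht, Real.inv_rpow (by positivity), ← Real.rpow_natCast, ← Real.rpow_mul hz0.le,
      ← Real.rpow_neg hz0.le]
    norm_num
  -- Bernoulli's inequality for the concave power when `r ≤ 1`; for `r ≥ 1` simply `t ^ r ≤ t`.
  have key : 1 - t ≤ (1 + r⁻¹) * (1 - t ^ r) := by
    rcases le_total r 1 with h | h
    · have := rpow_one_add_le_one_add_mul_self (s := t - 1) (by linarith) hr.le h
      rw [show 1 + (t - 1) = t by ring] at this
      have h3 : r⁻¹ * (r * (1 - t)) ≤ r⁻¹ * (1 - t ^ r) := by gcongr; linarith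
      rw [← mul_assoc, inv_mul_cancel₀ hr.ne', one_mul] at h3
      rw [hW] at h1
      linarith
    · have : t ^ r ≤ t ^ (1 : ℝ) := Real.rpow_le_rpow_of_exponent_ge htpos htle h
      rw [Real.rpow_one] at this
      rw [hW] at h1
      nlinarith [mul_nonneg hri.le (sub_nonneg.2 h1)]
  rw [speedSq_zero, hW]
  rw [hW] at h1
  nlinarith [mul_le_mul_of_nonneg_left key (by positivity : 0 ≤ z ^ 2),
    mul_nonneg (sub_nonneg.2 hz2) (sub_nonneg.2 h1)]

lemma slowness_nonneg : 0 ≤ slowness r σ z := by unfold slowness; positivity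

lemma slowness_pos (hr : 0 < r) (hσ : 0 ≤ σ) (hz : 1 < z) : 0 < slowness r σ z := by
  have := speedSq_pos hr hσ hz
  unfold slowness; positivity

lemma slowness_antitoneOn (hr : 0 < r) (hz : 1 < z) :
    AntitoneOn (fun σ => slowness r σ z) (Set.Ici 0) := by
  intro a ha b hb hab
  have := speedSq_pos hr ha hz
  exact inv_anti₀ (by positivity) (Real.sqrt_le_sqrt (speedSq_mono hr hz.le hab))

lemma slowness_le (hr : 0 < r) (hσ : 0 ≤ σ) (hz : 1 < z) : slowness r σ z ≤ slowness r 0 z :=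
  slowness_antitoneOn hr hz Set.self_mem_Ici hσ hσ

lemma slowness_le_div (hr : 0 < r) (hσ : 0 < σ) (hz : 1 < z) :
    slowness r σ z ≤ (√σ)⁻¹ * (z⁻¹ * slowness r 0 z) := by
  have h0 := speedSq_pos hr le_rfl hz
  have hz0 : 0 < z := by linarith
  have h := Real.sqrt_le_sqrt (le_speedSq hr hσ.le hz.le)
  rw [Real.sqrt_mul (by positivity), Real.sqrt_mul hσ.le, Real.sqrt_sq hz0.le] at h
  have := inv_anti₀ (by positivity) h
  rw [mul_inv, mul_inv, mul_assoc] at this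
  exact this

lemma slowness_sq (hr : 0 < r) (hσ : 0 ≤ σ) (hz : 1 < z) :
    slowness r σ z ^ 2 * speedSq r σ z = 1 := by
  have := speedSq_pos hr hσ hz
  rw [slowness, inv_pow, Real.sq_sqrt this.le, inv_mul_cancel₀ this.ne']

lemma slownessVar_nonneg (hr : 0 < r) (hz : 1 ≤ z) : 0 ≤ slownessVar r σ z := by
  have := sq_sub_weight_nonneg hr hz
  have := slowness_nonneg (r := r) (σ := σ) (z := z)
  unfold slownessVar; positivity

/-- Uniform in `σ ≥ 0`, at the price of the growth `z²`: this is the dominating function for all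
limits `σ ↓ 0`. -/
lemma slownessVar_le (hr : 0 < r) (hσ : 0 ≤ σ) (hz : 1 < z) :
    slownessVar r σ z ≤ (2 + r⁻¹) / 2 * (z ^ 2 * slowness r 0 z) := by
  have h1 := sq_sub_weight_le hr hz.le
  have h2 : speedSq r 0 z ≤ speedSq r σ z := speedSq_mono hr hz.le hσ
  have h3 := slowness_sq hr hσ hz
  have h4 := slowness_le hr hσ hz
  have h5 := slowness_pos hr hσ hz
  have h6 : (z ^ 2 - z ^ (-(2 * r))) * slowness r σ z ^ 2 ≤ (2 + r⁻¹) * z ^ 2 := by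
    calc _ ≤ (2 + r⁻¹) * z ^ 2 * speedSq r σ z * slowness r σ z ^ 2 := by
          gcongr
          exact h1.trans (by gcongr)
      _ = (2 + r⁻¹) * z ^ 2 * (slowness r σ z ^ 2 * speedSq r σ z) := by ring
      _ = _ := by rw [h3, mul_one]
  calc slownessVar r σ z = (z ^ 2 - z ^ (-(2 * r))) * slowness r σ z ^ 2 / 2 * slowness r σ z := by
        unfold slownessVar; ring
    _ ≤ (2 + r⁻¹) * z ^ 2 / 2 * slowness r 0 z := by gcongr
    _ = _ := by ring

/-- Complements the uniform bound: no growth in `z`, but a constant that blows up as `σ ↓ 0`. It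
serves for differentiation at a fixed positive `σ`. -/
lemma slownessVar_le_div (hr : 0 < r) (hσ : 0 < σ) (hz : 1 < z) :
    slownessVar r σ z ≤ (2 * σ)⁻¹ * slowness r σ z := by
  have h3 := slowness_sq hr hσ.le hz
  have h5 := slowness_pos hr hσ.le hz
  have h0 := weight_lt_one hr hz
  have h6 : σ * (z ^ 2 - z ^ (-(2 * r))) * slowness r σ z ^ 2 ≤ 1 := by
    rw [← h3, mul_comm]
    gcongr
    unfold speedSq
    linarith
  calc slownessVar r σ z
      = (2 * σ)⁻¹ * (σ * (z ^ 2 - z ^ (-(2 * r))) * slowness r σ z ^ 2 * slowness r σ z) := by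
        unfold slownessVar; field_simp
    _ ≤ (2 * σ)⁻¹ * (1 * slowness r σ z) := by gcongr
    _ = _ := by ring

lemma hasDerivAt_speedSq_param : HasDerivAt (fun s => speedSq r s z) (z ^ 2 - z ^ (-(2 * r))) σ := by
  unfold speedSq
  simpa using ((hasDerivAt_id σ).mul_const (z ^ 2 - z ^ (-(2 * r)))).add_const (1 - z ^ (-(2 * r)))

lemma hasDerivAt_slowness_param (hr : 0 < r) (hσ : 0 ≤ σ) (hz : 1 < z) :
    HasDerivAt (fun s => slowness r s z) (-slownessVar r σ z) σ := by
  have h := speedSq_pos hr hσ hz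
  have hs : √(speedSq r σ z) ≠ 0 := by positivity
  refine (((hasDerivAt_speedSq_param (r := r) (z := z) (σ := σ)).sqrt h.ne').fun_inv hs).congr_deriv
    ?_
  unfold slownessVar slowness
  field_simp

@[fun_prop]
lemma measurable_slowness : Measurable (slowness r σ) := by
  unfold slowness speedSq
  fun_prop

@[fun_prop]
lemma measurable_slownessVar : Measurable (slownessVar r σ) := by
  unfold slownessVar
  fun_prop

lemma continuousOn_speedSq : ContinuousOn (speedSq r σ) (Set.Ioi 0) := by
  unfold speedSq
  have : ContinuousOn (fun z : ℝ => z ^ (-(2 * r))) (Set.Ioi 0) := fun z hz =>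
    (Real.continuousAt_rpow_const z _ (Or.inl (ne_of_gt hz))).continuousWithinAt
  fun_prop

lemma continuousOn_slowness (hr : 0 < r) (hσ : 0 ≤ σ) :
    ContinuousOn (slowness r σ) (Set.Ioi 1) :=
  (Real.continuous_sqrt.comp_continuousOn
    (continuousOn_speedSq.mono (Set.Ioi_subset_Ioi zero_le_one))).inv₀
    fun _ hz => (Real.sqrt_pos.2 (speedSq_pos hr hσ hz)).ne'

end Bounds

/-! ### Integrability of the slowness near height one and at infinity -/

section Integrability

variable {r σ : ℝ}

/-- Away from `z = 1` the slowness is bounded and the power decides. The singularity at `z = 1` is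
carried by `r z^(-2r-1) slowness`, which is the derivative of the bounded increasing function
`√(speedSq r 0 z)`. -/
lemma integrableOn_rpow_mul_slowness_zero (hr : 0 < r) {s : ℝ} (hs : 1 < s) :
    IntegrableOn (fun z => z ^ (-s) * slowness r 0 z) (Set.Ioi 1) := by
  have h1 : IntegrableOn (fun z : ℝ => z ^ (-s)) (Set.Ioi 1) :=
    integrableOn_Ioi_rpow_of_lt (by linarith) one_pos
  have h2 : IntegrableOn (fun z : ℝ => r * z ^ (-(2 * r) - 1) * slowness r 0 z) (Set.Ioi 1) := by
    have hd : ∀ z : ℝ, 0 < z → HasDerivAt (fun z : ℝ => speedSq r 0 z)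
        (2 * r * z ^ (-(2 * r) - 1)) z := by
      intro z hz
      simp only [speedSq_zero]
      exact ((Real.hasDerivAt_rpow_const (p := -(2 * r)) (Or.inl hz.ne')).const_sub 1).congr_deriv
        (by ring)
    refine integrableOn_Ioi_deriv_of_nonneg (g := fun z => √(speedSq r 0 z)) (l := 1) ?_ ?_ ?_ ?_
    · exact ((hd 1 one_pos).continuousAt.sqrt).continuousWithinAt
    · intro z hz
      convert (hd z (one_pos.trans hz)).sqrt (speedSq_pos hr le_rfl hz).ne' using 1
      unfold slowness
      field_simp
    · intro z hz
      have := slowness_nonneg (r := r) (σ := 0) (z := z)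
      have : 0 < z := one_pos.trans hz
      positivity
    · have : Tendsto (fun z : ℝ => speedSq r 0 z) atTop (𝓝 (1 - 0)) := by
        simp only [speedSq_zero]
        exact (tendsto_rpow_neg_atTop (by linarith)).const_sub 1
      simpa using this.sqrt
  refine (h1.add (h2.const_mul r⁻¹)).mono' (by fun_prop) ?_
  refine (ae_restrict_mem measurableSet_Ioi).mono fun z hz => ?_
  have hz1 : (1 : ℝ) < z := hz
  have hz0 : 0 < z := by linarith
  have hF := slowness_pos hr le_rfl hz1
  -- Since `slowness² (1 - z^(-2r)) = 1` and the slowness is at least `1`, the product `slowness (1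
  -- - z^(-2r))` is at most `1`.
  have hle : slowness r 0 z ≤ 1 + z ^ (-(2 * r)) * slowness r 0 z := by
    have hw := weight_lt_one hr hz1
    have hw0 := weight_pos (r := r) hz1.le
    have hsq := slowness_sq hr le_rfl hz1
    rw [speedSq_zero] at hsq
    by_contra! hcon
    have : 1 ≤ slowness r 0 z := by nlinarith [sq_nonneg (slowness r 0 z)]
    nlinarith [mul_nonneg hF.le (sub_nonneg.2 this)]
  have hexp : z ^ (-s) * z ^ (-(2 * r)) ≤ z ^ (-(2 * r) - 1) := by
    rw [← Real.rpow_add hz0]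
    exact Real.rpow_le_rpow_of_exponent_le hz1.le (by linarith)
  have hs0 : 0 < z ^ (-s) := Real.rpow_pos_of_pos hz0 _
  rw [Real.norm_of_nonneg (by positivity)]
  simp only [Pi.add_apply]
  calc z ^ (-s) * slowness r 0 z ≤ z ^ (-s) * (1 + z ^ (-(2 * r)) * slowness r 0 z) := by gcongr
    _ = z ^ (-s) + z ^ (-s) * z ^ (-(2 * r)) * slowness r 0 z := by ring
    _ ≤ z ^ (-s) + z ^ (-(2 * r) - 1) * slowness r 0 z := by gcongr
    _ = _ := by field_simp

lemma integrableOn_rpow_mul_slowness (hr : 0 < r) (hσ : 0 < σ) {s : ℝ} (hs : 0 < s) :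
    IntegrableOn (fun z => z ^ (-s) * slowness r σ z) (Set.Ioi 1) := by
  refine ((integrableOn_rpow_mul_slowness_zero hr (s := s + 1) (by linarith)).const_mul
    (√σ)⁻¹).mono' (by fun_prop) ?_
  refine (ae_restrict_mem measurableSet_Ioi).mono fun z hz => ?_
  have hz0 : (0 : ℝ) < z := one_pos.trans hz
  have := slowness_pos hr hσ.le hz
  have h2 := slowness_le_div hr hσ hz
  rw [Real.norm_of_nonneg (by positivity)]
  calc _ ≤ z ^ (-s) * ((√σ)⁻¹ * (z⁻¹ * slowness r 0 z)) := by gcongr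
    _ = (√σ)⁻¹ * (z ^ (-s) * z ^ (-1 : ℝ) * slowness r 0 z) := by rw [Real.rpow_neg_one]; ring
    _ = _ := by rw [← Real.rpow_add hz0, neg_add]

lemma intervalIntegrable_sq_mul_slowness_zero (hr : 0 < r) {a b : ℝ} (ha : 1 ≤ a) (hb : 1 ≤ b) :
    IntervalIntegrable (fun z => z ^ 2 * slowness r 0 z) volume a b := by
  rw [intervalIntegrable_iff]
  have hsub : Set.uIoc a b ⊆ Set.Ioc 1 (max a b) := by
    intro x hx
    exact ⟨(le_min ha hb).trans_lt hx.1, hx.2⟩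
  refine IntegrableOn.mono_set ?_ hsub
  have h := (integrableOn_rpow_mul_slowness_zero hr (s := 2) (by norm_num)).mono_set
    (Set.Ioc_subset_Ioi_self : Set.Ioc 1 (max a b) ⊆ Set.Ioi 1)
  -- On a bounded range `z² ≤ (max a b)⁴ z⁻²`, which reduces the claim to the integrable power `s =
  -- 2`.
  refine (h.const_mul (max a b ^ 4)).mono' (by fun_prop) ?_
  refine (ae_restrict_mem measurableSet_Ioc).mono fun z hz => ?_
  have hz0 : (0 : ℝ) < z := one_pos.trans hz.1
  have := slowness_pos hr le_rfl hz.1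
  rw [Real.norm_of_nonneg (by positivity), ← mul_assoc]
  gcongr
  rw [Real.rpow_neg hz0.le, ← div_eq_mul_inv, le_div_iff₀ (by positivity)]
  have : z ^ 4 ≤ max a b ^ 4 := by gcongr; exact hz.2
  calc _ = z ^ 4 := by norm_cast; ring
    _ ≤ _ := this

lemma uIoc_subset_Ioi_one {a b : ℝ} (ha : 1 ≤ a) (hb : 1 ≤ b) : Set.uIoc a b ⊆ Set.Ioi 1 :=
  fun _ hx => (le_min ha hb).trans_lt hx.1

lemma intervalIntegrable_slowness (hr : 0 < r) (hσ : 0 ≤ σ) {a b : ℝ} (ha : 1 ≤ a) (hb : 1 ≤ b) :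
    IntervalIntegrable (slowness r σ) volume a b := by
  refine (intervalIntegrable_sq_mul_slowness_zero hr ha hb).mono_fun' (by fun_prop) ?_
  refine (ae_restrict_mem measurableSet_uIoc).mono fun z hz => ?_
  have hz1 : 1 < z := uIoc_subset_Ioi_one ha hb hz
  have h := slowness_le hr hσ hz1
  have h0 := slowness_pos hr hσ hz1
  have h00 := slowness_pos hr le_rfl hz1
  simp only [Real.norm_of_nonneg h0.le]
  nlinarith [mul_nonneg (show 0 ≤ z ^ 2 - 1 by nlinarith) h00.le]

lemma intervalIntegrable_slownessVar (hr : 0 < r) (hσ : 0 ≤ σ) {a b : ℝ} (ha : 1 ≤ a)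
    (hb : 1 ≤ b) : IntervalIntegrable (slownessVar r σ) volume a b := by
  refine ((intervalIntegrable_sq_mul_slowness_zero hr ha hb).const_mul ((2 + r⁻¹) / 2)).mono_fun'
    (by fun_prop) ?_
  refine (ae_restrict_mem measurableSet_uIoc).mono fun z hz => ?_
  have hz1 : 1 < z := uIoc_subset_Ioi_one ha hb hz
  simp only [Real.norm_of_nonneg (slownessVar_nonneg hr hz1.le)]
  exact slownessVar_le hr hσ hz1

end Integrability

/-! ### Travel time as a function of height and parameter -/

/-- Time needed by the normalised profile to climb from `1` to `z`. -/
noncomputable def travelTime (r σ z : ℝ) : ℝ := ∫ t in (1 : ℝ)..z, slowness r σ t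

/-- Minus the derivative of `travelTime r σ z` in `σ`. -/
noncomputable def travelTimeVar (r σ z : ℝ) : ℝ := ∫ t in (1 : ℝ)..z, slownessVar r σ t

/-- The normalised profile: the inverse of `travelTime r σ` on `[1, ∞)`. -/
noncomputable def profile (r σ y : ℝ) : ℝ := Function.invFunOn (travelTime r σ) (Set.Ici 1) y

lemma surjOn_Ici_of_tendsto_atTop {f : ℝ → ℝ} {a : ℝ} (hf : ContinuousOn f (Set.Ici a))
    (hf' : Tendsto f atTop atTop) : Set.SurjOn f (Set.Ici a) (Set.Ici (f a)) := by
  intro y hy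
  obtain ⟨b, hb⟩ := ((hf'.eventually_ge_atTop y).and (eventually_ge_atTop a)).exists
  obtain ⟨x, hx, rfl⟩ := intermediate_value_Icc hb.2 (hf.mono Set.Icc_subset_Ici_self) ⟨hy, hb.1⟩
  exact ⟨x, hx.1, rfl⟩

lemma continuousOn_primitive_Ici {f : ℝ → ℝ} {a : ℝ}
    (hf : ∀ b, a ≤ b → IntervalIntegrable f volume a b) :
    ContinuousOn (fun z => ∫ t in a..z, f t) (Set.Ici a) := by
  intro z hz
  have hz : a ≤ z := hz
  have h := intervalIntegral.continuousOn_primitive_interval' (hf (z + 1) (by linarith))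
    Set.left_mem_uIcc
  rw [Set.uIcc_of_le (by linarith)] at h
  refine (h z ⟨hz, by linarith⟩).mono_of_mem_nhdsWithin ?_
  exact inter_mem_nhdsWithin _ (Iic_mem_nhds (by linarith))

section

variable {r σ z : ℝ}

@[simp] lemma travelTime_one : travelTime r σ 1 = 0 := by simp [travelTime]

@[simp] lemma travelTimeVar_one : travelTimeVar r σ 1 = 0 := by simp [travelTimeVar]

lemma continuousOn_travelTime (hr : 0 < r) (hσ : 0 ≤ σ) :
    ContinuousOn (travelTime r σ) (Set.Ici 1) :=
  continuousOn_primitive_Ici fun _ hb => intervalIntegrable_slowness hr hσ le_rfl hb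

lemma continuousOn_travelTimeVar (hr : 0 < r) (hσ : 0 ≤ σ) :
    ContinuousOn (travelTimeVar r σ) (Set.Ici 1) :=
  continuousOn_primitive_Ici fun _ hb => intervalIntegrable_slownessVar hr hσ le_rfl hb

lemma travelTimeVar_nonneg (hr : 0 < r) (hz : 1 ≤ z) : 0 ≤ travelTimeVar r σ z :=
  intervalIntegral.integral_nonneg hz fun _ ht => slownessVar_nonneg hr ht.1

lemma strictMonoOn_travelTime (hr : 0 < r) (hσ : 0 ≤ σ) :
    StrictMonoOn (travelTime r σ) (Set.Ici 1) := by
  intro x hx y hy hxy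
  rw [← sub_pos]
  unfold travelTime
  rw [intervalIntegral.integral_interval_sub_left
    (intervalIntegrable_slowness hr hσ le_rfl hy) (intervalIntegrable_slowness hr hσ le_rfl hx)]
  exact intervalIntegral.intervalIntegral_pos_of_pos_on (intervalIntegrable_slowness hr hσ hx hy)
    (fun t ht => slowness_pos hr hσ (lt_of_le_of_lt hx ht.1)) hxy

lemma hasDerivAt_travelTime (hr : 0 < r) (hσ : 0 ≤ σ) (hz : 1 < z) :
    HasDerivAt (travelTime r σ) (slowness r σ z) z :=
  intervalIntegral.integral_hasDerivAt_right (intervalIntegrable_slowness hr hσ le_rfl hz.le)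
    (measurable_slowness.stronglyMeasurable.stronglyMeasurableAtFilter)
    ((continuousOn_slowness hr hσ).continuousAt (Ioi_mem_nhds hz))

/-- The speed is at most `√(1+σ) z`, so the climb is at most exponential. Infinite height is
therefore not reached in finite time, and the profile is defined on the whole half-line. -/
lemma log_le_travelTime (hr : 0 < r) (hσ : 0 ≤ σ) (hz : 1 ≤ z) :
    (√(1 + σ))⁻¹ * Real.log z ≤ travelTime r σ z := by
  have h0 : (0 : ℝ) ∉ Set.uIcc 1 z := by
    rw [Set.uIcc_of_le hz]; intro h; linarith [h.1]
  have : (√(1 + σ))⁻¹ * Real.log z = ∫ t in (1 : ℝ)..z, (√(1 + σ))⁻¹ * t⁻¹ := by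
    rw [intervalIntegral.integral_const_mul, integral_inv h0, div_one]
  rw [this]
  refine intervalIntegral.integral_mono_on_of_le_Ioo hz
    ((intervalIntegrable_inv_iff.2 (Or.inr h0)).const_mul _)
    (intervalIntegrable_slowness hr hσ le_rfl hz) fun t ht => ?_
  have ht0 : (0 : ℝ) < t := one_pos.trans ht.1
  have h1 := speedSq_pos hr hσ ht.1
  rw [← mul_inv]
  refine inv_anti₀ (by positivity) ?_
  refine Real.sqrt_le_iff.2 ⟨by positivity, ?_⟩
  rw [mul_pow, Real.sq_sqrt (by positivity)]
  exact speedSq_le hσ ht.1.le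

lemma tendsto_travelTime (hr : 0 < r) (hσ : 0 ≤ σ) :
    Tendsto (travelTime r σ) atTop atTop := by
  refine tendsto_atTop_mono' _ ?_ (Real.tendsto_log_atTop.const_mul_atTop
    (show 0 < (√(1 + σ))⁻¹ by positivity))
  filter_upwards [eventually_ge_atTop 1] with z hz using log_le_travelTime hr hσ hz

lemma continuousOn_travelTime_param (hr : 0 < r) (hz : 1 ≤ z) :
    ContinuousOn (fun s => travelTime r s z) (Set.Ici 0) := by
  intro s hs
  refine intervalIntegral.continuousWithinAt_of_dominated_interval (bound := slowness r 0)
    (Eventually.of_forall fun _ => by fun_prop) ?_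
    (intervalIntegrable_slowness hr le_rfl le_rfl hz) ?_
  · filter_upwards [self_mem_nhdsWithin] with s hs
    refine Eventually.of_forall fun t ht => ?_
    rw [Real.norm_of_nonneg slowness_nonneg]
    exact slowness_le hr hs (uIoc_subset_Ioi_one le_rfl hz ht)
  · exact Eventually.of_forall fun t ht => (hasDerivAt_slowness_param hr hs
      (uIoc_subset_Ioi_one le_rfl hz ht)).continuousAt.continuousWithinAt

lemma continuousWithinAt_slownessVar_param (hr : 0 < r) (hσ : 0 ≤ σ) (hz : 1 < z)
    (S : Set ℝ) : ContinuousWithinAt (fun s => slownessVar r s z) S σ :=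
  (((hasDerivAt_slowness_param hr hσ hz).continuousAt.pow 3).const_mul _).continuousWithinAt

lemma continuousOn_travelTimeVar_param (hr : 0 < r) (hz : 1 ≤ z) :
    ContinuousOn (fun s => travelTimeVar r s z) (Set.Ici 0) := by
  intro s hs
  refine intervalIntegral.continuousWithinAt_of_dominated_interval
    (bound := fun t => (2 + r⁻¹) / 2 * (t ^ 2 * slowness r 0 t))
    (Eventually.of_forall fun _ => by fun_prop) ?_
    ((intervalIntegrable_sq_mul_slowness_zero hr le_rfl hz).const_mul _) ?_
  · filter_upwards [self_mem_nhdsWithin] with s hs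
    refine Eventually.of_forall fun t ht => ?_
    have ht := uIoc_subset_Ioi_one le_rfl hz ht
    rw [Real.norm_of_nonneg (slownessVar_nonneg hr (le_of_lt ht))]
    exact slownessVar_le hr hs ht
  · exact Eventually.of_forall fun t ht => continuousWithinAt_slownessVar_param hr hs
      (uIoc_subset_Ioi_one le_rfl hz ht) _

/-! ### The profile: continuity and implicit differentiation -/

section Profile

variable {y : ℝ}

lemma surjOn_travelTime (hr : 0 < r) (hσ : 0 ≤ σ) :
    Set.SurjOn (travelTime r σ) (Set.Ici 1) (Set.Ici 0) := by
  simpa using surjOn_Ici_of_tendsto_atTop (continuousOn_travelTime hr hσ) (tendsto_travelTime hr hσ)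

lemma one_le_profile (hr : 0 < r) (hσ : 0 ≤ σ) (hy : 0 ≤ y) : 1 ≤ profile r σ y :=
  Function.invFunOn_mem (surjOn_travelTime hr hσ hy)

lemma travelTime_profile (hr : 0 < r) (hσ : 0 ≤ σ) (hy : 0 ≤ y) :
    travelTime r σ (profile r σ y) = y :=
  Function.invFunOn_eq (surjOn_travelTime hr hσ hy)

lemma travelTime_nonneg (hr : 0 < r) (hσ : 0 ≤ σ) (hz : 1 ≤ z) : 0 ≤ travelTime r σ z := by
  simpa using (strictMonoOn_travelTime hr hσ).monotoneOn Set.self_mem_Ici hz hz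

lemma profile_travelTime (hr : 0 < r) (hσ : 0 ≤ σ) (hz : 1 ≤ z) :
    profile r σ (travelTime r σ z) = z :=
  (strictMonoOn_travelTime hr hσ).injOn (one_le_profile hr hσ (travelTime_nonneg hr hσ hz)) hz
    (travelTime_profile hr hσ (travelTime_nonneg hr hσ hz))

lemma lt_profile_iff (hr : 0 < r) (hσ : 0 ≤ σ) (hz : 1 ≤ z) (hy : 0 ≤ y) :
    z < profile r σ y ↔ travelTime r σ z < y := by
  rw [← (strictMonoOn_travelTime hr hσ).lt_iff_lt hz (one_le_profile hr hσ hy),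
    travelTime_profile hr hσ hy]

lemma profile_lt_iff (hr : 0 < r) (hσ : 0 ≤ σ) (hz : 1 ≤ z) (hy : 0 ≤ y) :
    profile r σ y < z ↔ y < travelTime r σ z := by
  rw [← (strictMonoOn_travelTime hr hσ).lt_iff_lt (one_le_profile hr hσ hy) hz,
    travelTime_profile hr hσ hy]

lemma strictMonoOn_profile (hr : 0 < r) (hσ : 0 ≤ σ) :
    StrictMonoOn (profile r σ) (Set.Ici 0) := by
  intro x hx y hy hxy
  rw [lt_profile_iff hr hσ (one_le_profile hr hσ hx) hy, travelTime_profile hr hσ hx]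
  exact hxy

lemma profile_zero (hr : 0 < r) (hσ : 0 ≤ σ) : profile r σ 0 = 1 := by
  simpa using profile_travelTime hr hσ le_rfl

lemma one_lt_profile (hr : 0 < r) (hσ : 0 ≤ σ) (hy : 0 < y) : 1 < profile r σ y := by
  rw [lt_profile_iff hr hσ le_rfl hy.le]
  simpa using hy

lemma tendsto_profile_atTop (hr : 0 < r) (hσ : 0 ≤ σ) :
    Tendsto (profile r σ) atTop atTop := by
  refine tendsto_atTop.2 fun b => ?_
  filter_upwards [eventually_gt_atTop (travelTime r σ (max b 1)), eventually_ge_atTop 0] with y hy h0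
  exact (le_max_left b 1).trans ((lt_profile_iff hr hσ (le_max_right b 1) h0).2 hy).le

/-- Joint continuity in parameter and time: by monotonicity `z < V_σ(y)` means `T_σ(z) < y`, so
continuity of the travel time in `σ` at each fixed height is enough. -/
lemma tendsto_profile {ι : Type*} {l : Filter ι} {s y : ι → ℝ} {s₀ y₀ : ℝ} (hr : 0 < r)
    (hs : Tendsto s l (𝓝 s₀)) (hs0 : ∀ᶠ i in l, 0 ≤ s i) (hs₀ : 0 ≤ s₀)
    (hy : Tendsto y l (𝓝 y₀)) (hy0 : ∀ᶠ i in l, 0 ≤ y i) (hy₀ : 0 ≤ y₀) :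
    Tendsto (fun i => profile r (s i) (y i)) l (𝓝 (profile r s₀ y₀)) := by
  have hT : ∀ z, 1 ≤ z → Tendsto (fun i => travelTime r (s i) z) l (𝓝 (travelTime r s₀ z)) :=
    fun z hz => (continuousOn_travelTime_param hr hz s₀ hs₀).tendsto.comp
      (tendsto_nhdsWithin_iff.2 ⟨hs, hs0⟩)
  refine tendsto_order.2 ⟨fun a ha => ?_, fun b hb => ?_⟩
  · rcases lt_or_ge a 1 with h1 | h1
    · filter_upwards [hs0, hy0] with i hi hi' using h1.trans_le (one_le_profile hr hi hi')
    · rw [lt_profile_iff hr hs₀ h1 hy₀] at ha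
      filter_upwards [hs0, hy0, (hT a h1).eventually_lt hy ha] with i hi hi' h
      exact (lt_profile_iff hr hi h1 hi').2 h
  · have h1 : 1 ≤ b := (one_le_profile hr hs₀ hy₀).trans hb.le
    rw [gt_iff_lt, profile_lt_iff hr hs₀ h1 hy₀] at hb
    filter_upwards [hs0, hy0, hy.eventually_lt (hT b h1) hb] with i hi hi' h
    exact (profile_lt_iff hr hi h1 hi').2 h

lemma continuousOn_profile (hr : 0 < r) (hσ : 0 ≤ σ) :
    ContinuousOn (profile r σ) (Set.Ici 0) := fun _ hy =>
  tendsto_profile hr tendsto_const_nhds (Eventually.of_forall fun _ => hσ) hσ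
    (tendsto_id.mono_left inf_le_left) self_mem_nhdsWithin hy

lemma hasDerivAt_profile (hr : 0 < r) (hσ : 0 ≤ σ) (hy : 0 < y) :
    HasDerivAt (profile r σ) √(speedSq r σ (profile r σ y)) y := by
  have h1 := one_lt_profile hr hσ hy
  have := HasDerivAt.of_local_left_inverse
    ((continuousOn_profile hr hσ).continuousAt (Ici_mem_nhds hy))
    (hasDerivAt_travelTime hr hσ h1) (slowness_pos hr hσ h1).ne'
    (by filter_upwards [Ioi_mem_nhds hy] with x hx using travelTime_profile hr hσ (le_of_lt hx))
  simpa [slowness] using this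

lemma abs_slowness_sub_le (hr : 0 < r) {s t : ℝ} (hs : 0 ≤ s) (ht : 0 ≤ t) (hz : 1 < z) :
    |slowness r s z - slowness r t z| ≤ (2 + r⁻¹) / 2 * (z ^ 2 * slowness r 0 z) * |s - t| :=
  (convex_Ici (0 : ℝ)).norm_image_sub_le_of_norm_hasDerivWithin_le
    (fun u hu => (hasDerivAt_slowness_param hr hu hz).hasDerivWithinAt)
    (fun u hu => by
      rw [norm_neg, Real.norm_of_nonneg (slownessVar_nonneg hr hz.le)]
      exact slownessVar_le hr hu hz) ht hs

lemma hasDerivAt_travelTime_param (hr : 0 < r) (hσ : 0 < σ) (hz : 1 ≤ z) :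
    HasDerivAt (fun s => travelTime r s z) (-travelTimeVar r σ z) σ := by
  have := (intervalIntegral.hasDerivAt_integral_of_dominated_loc_of_deriv_le (μ := volume)
    (F := slowness r) (F' := fun s t => -slownessVar r s t) (x₀ := σ) (s := Set.Ioi 0)
    (a := 1) (b := z) (bound := fun t => (2 + r⁻¹) / 2 * (t ^ 2 * slowness r 0 t))
    (Ioi_mem_nhds hσ) (Eventually.of_forall fun _ => by fun_prop)
    (intervalIntegrable_slowness hr hσ.le le_rfl hz) (by fun_prop)
    (Eventually.of_forall fun t ht s hs => by
      have ht := uIoc_subset_Ioi_one le_rfl hz ht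
      rw [norm_neg, Real.norm_of_nonneg (slownessVar_nonneg hr (le_of_lt ht))]
      exact slownessVar_le hr (le_of_lt hs) ht)
    ((intervalIntegrable_sq_mul_slowness_zero hr le_rfl hz).const_mul _)
    (Eventually.of_forall fun t ht s hs => hasDerivAt_slowness_param hr (le_of_lt hs)
      (uIoc_subset_Ioi_one le_rfl hz ht))).2
  rwa [intervalIntegral.integral_neg] at this

/-- The integrand is bounded by `|s - σ|` times a fixed integrable function, and the interval
shrinks to a point, so the integral is `o(s - σ)`. -/
lemma hasDerivAt_integral_slowness_sub (hr : 0 < r) (hσ : 0 < σ) (hz : 1 ≤ z) {h : ℝ → ℝ}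
    (hh : Tendsto h (𝓝 σ) (𝓝 z)) (hh1 : ∀ᶠ s in 𝓝 σ, 1 ≤ h s) :
    HasDerivAt (fun s => ∫ t in z..h s, (slowness r s t - slowness r σ t)) 0 σ := by
  set B : ℝ → ℝ := fun t => (2 + r⁻¹) / 2 * (t ^ 2 * slowness r 0 t) with hB
  have hBint : ∀ b, 1 ≤ b → IntervalIntegrable B volume 1 b := fun b hb =>
    (intervalIntegrable_sq_mul_slowness_zero hr le_rfl hb).const_mul _
  have hlim : Tendsto (fun s => ∫ t in z..h s, B t) (𝓝 σ) (𝓝 0) := by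
    have h1 := (continuousOn_primitive_Ici hBint z hz).tendsto.comp
      (tendsto_nhdsWithin_iff.2 ⟨hh, hh1⟩)
    have h2 := h1.sub_const (∫ t in (1 : ℝ)..z, B t)
    rw [sub_self] at h2
    refine h2.congr' ?_
    filter_upwards [hh1] with s hs
    exact intervalIntegral.integral_interval_sub_left (hBint _ hs) (hBint _ hz)
  rw [hasDerivAt_iff_isLittleO]
  simp only [sub_self, intervalIntegral.integral_zero, sub_zero, smul_zero]
  have hO : (fun s => ∫ t in z..h s, (slowness r s t - slowness r σ t)) =O[𝓝 σ]
      fun s => (∫ t in z..h s, B t) * (s - σ) := by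
    refine Asymptotics.IsBigO.of_bound 1 ?_
    filter_upwards [hh1, Ioi_mem_nhds hσ] with s hs hs0
    rw [one_mul, norm_mul, Real.norm_eq_abs (s - σ), ← Real.norm_of_nonneg (abs_nonneg (s - σ)),
      ← norm_mul, ← intervalIntegral.integral_mul_const]
    refine intervalIntegral.norm_integral_le_abs_of_norm_le ?_
      (((hBint z hz).symm.trans (hBint _ hs)).mul_const _)
    refine (ae_restrict_mem measurableSet_uIoc).mono fun t ht => ?_
    exact abs_slowness_sub_le hr (le_of_lt hs0) hσ.le (uIoc_subset_Ioi_one hz hs ht)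
  refine hO.trans_isLittleO ?_
  have := ((Asymptotics.isLittleO_one_iff ℝ).2 hlim).mul_isBigO
    (Asymptotics.isBigO_refl (fun s => s - σ) (𝓝 σ))
  simpa using this

/-- Implicit differentiation of the profile along a curve in the parameter plane. -/
lemma hasDerivAt_profile_comp (hr : 0 < r) (hσ : 0 < σ) {y : ℝ → ℝ} {y' : ℝ}
    (hy : HasDerivAt y y' σ) (hy0 : 0 < y σ) :
    HasDerivAt (fun s => profile r s (y s))
      (√(speedSq r σ (profile r σ (y σ))) * (y' + travelTimeVar r σ (profile r σ (y σ)))) σ := by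
  set z := profile r σ (y σ) with hz
  have hz1 : 1 < z := one_lt_profile hr hσ.le hy0
  have hev : ∀ᶠ s in 𝓝 σ, 0 < s ∧ 0 < y s :=
    (eventually_gt_nhds hσ).and (hy.continuousAt.eventually (eventually_gt_nhds hy0))
  have hh1 : ∀ᶠ s in 𝓝 σ, 1 ≤ profile r s (y s) :=
    hev.mono fun s hs => one_le_profile hr hs.1.le hs.2.le
  have hh : Tendsto (fun s => profile r s (y s)) (𝓝 σ) (𝓝 z) :=
    tendsto_profile hr tendsto_id (hev.mono fun s hs => hs.1.le) hσ.le hy.continuousAt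
      (hev.mono fun s hs => hs.2.le) hy0.le
  -- The moving height is measured on the fixed clock `T_σ`. With `h = V_s(y(s))`, one has `T_σ(h) =
  -- y(s) - (T_s(z) - T_σ(z)) - ∫_z^h (slowness_s - slowness_σ)`, and the last term has derivative
  -- zero. Composing with the fixed profile `V_σ` then avoids any joint differentiability.
  have hY : HasDerivAt (fun s => travelTime r σ (profile r s (y s)))
      (y' + travelTimeVar r σ z) σ := by
    have h := (hy.sub ((hasDerivAt_travelTime_param hr hσ hz1.le).sub_const
      (travelTime r σ z))).sub (hasDerivAt_integral_slowness_sub hr hσ hz1.le hh hh1)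
    refine (h.congr_deriv (by ring)).congr_of_eventuallyEq ?_
    filter_upwards [hev, hh1] with s hs hs1
    have hI : ∀ u, 0 ≤ u → ∫ t in z..profile r s (y s), slowness r u t =
        travelTime r u (profile r s (y s)) - travelTime r u z := fun u hu =>
      (intervalIntegral.integral_interval_sub_left
        (intervalIntegrable_slowness hr hu le_rfl hs1)
        (intervalIntegrable_slowness hr hu le_rfl hz1.le)).symm
    simp only [Pi.sub_apply]
    rw [intervalIntegral.integral_sub (intervalIntegrable_slowness hr hs.1.le hz1.le hs1)
      (intervalIntegrable_slowness hr hσ.le hz1.le hs1), hI _ hs.1.le, hI _ hσ.le,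
      travelTime_profile hr hs.1.le hs.2.le]
    ring
  have hP : HasDerivAt (profile r σ) √(speedSq r σ z) (travelTime r σ z) := by
    rw [hz, travelTime_profile hr hσ.le hy0.le]
    exact hasDerivAt_profile hr hσ.le hy0
  refine (hP.comp σ hY).congr_of_eventuallyEq ?_
  filter_upwards [hh1] with s hs
  exact (profile_travelTime hr hσ.le hs).symm

/-- Used at `σ = 0`, where the derivatives in `σ` are obtained only as limits from positive
parameters. -/
lemma tendsto_travelTimeVar_comp {ι : Type*} {l : Filter ι} {s h : ι → ℝ} {s₀ : ℝ} (hr : 0 < r)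
    (hs : Tendsto s l (𝓝 s₀)) (hs0 : ∀ᶠ i in l, 0 ≤ s i) (hs₀ : 0 ≤ s₀) (hz : 1 ≤ z)
    (hh : Tendsto h l (𝓝 z)) (hh1 : ∀ᶠ i in l, 1 ≤ h i) :
    Tendsto (fun i => travelTimeVar r (s i) (h i)) l (𝓝 (travelTimeVar r s₀ z)) := by
  set B : ℝ → ℝ := fun t => (2 + r⁻¹) / 2 * (t ^ 2 * slowness r 0 t) with hB
  have hBint : ∀ b, 1 ≤ b → IntervalIntegrable B volume 1 b := fun b hb =>
    (intervalIntegrable_sq_mul_slowness_zero hr le_rfl hb).const_mul _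
  have hlim : Tendsto (fun i => |∫ t in z..h i, B t|) l (𝓝 0) := by
    have h1 := (continuousOn_primitive_Ici hBint z hz).tendsto.comp
      (tendsto_nhdsWithin_iff.2 ⟨hh, hh1⟩)
    have h2 := (h1.sub_const (∫ t in (1 : ℝ)..z, B t)).abs
    rw [sub_self, abs_zero] at h2
    refine h2.congr' ?_
    filter_upwards [hh1] with s hs
    exact congrArg _ (intervalIntegral.integral_interval_sub_left (hBint _ hs) (hBint _ hz))
  have h1 : Tendsto (fun i => travelTimeVar r (s i) z) l (𝓝 (travelTimeVar r s₀ z)) :=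
    (continuousOn_travelTimeVar_param hr hz s₀ hs₀).tendsto.comp
      (tendsto_nhdsWithin_iff.2 ⟨hs, hs0⟩)
  have h2 : Tendsto (fun i => travelTimeVar r (s i) (h i) - travelTimeVar r (s i) z) l (𝓝 0) := by
    refine squeeze_zero_norm' ?_ hlim
    filter_upwards [hs0, hh1] with i hi hi1
    unfold travelTimeVar
    rw [intervalIntegral.integral_interval_sub_left
      (intervalIntegrable_slownessVar hr hi le_rfl hi1)
      (intervalIntegrable_slownessVar hr hi le_rfl hz)]
    refine intervalIntegral.norm_integral_le_abs_of_norm_le ?_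
      ((hBint z hz).symm.trans (hBint _ hi1))
    refine (ae_restrict_mem measurableSet_uIoc).mono fun t ht => ?_
    have ht := uIoc_subset_Ioi_one hz hi1 ht
    rw [Real.norm_of_nonneg (slownessVar_nonneg hr (le_of_lt ht))]
    exact slownessVar_le hr hi ht
  simpa using h1.add h2

end Profile

end

/-! ### Even extension of the profile and its regularity at the origin -/

section EvenProfile

variable {r σ : ℝ}

lemma one_le_profile_abs (hr : 0 < r) (hσ : 0 ≤ σ) (y : ℝ) : 1 ≤ profile r σ |y| :=
  one_le_profile hr hσ (abs_nonneg y)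

lemma continuous_profile_abs (hr : 0 < r) (hσ : 0 ≤ σ) :
    Continuous fun y => profile r σ |y| :=
  (continuousOn_profile hr hσ).comp_continuous continuous_abs fun y => abs_nonneg y

lemma continuous_speedSq_profile_abs (hr : 0 < r) (hσ : 0 ≤ σ) :
    Continuous fun y => speedSq r σ (profile r σ |y|) :=
  continuousOn_speedSq.comp_continuous (continuous_profile_abs hr hσ)
    fun y => one_pos.trans_le (one_le_profile_abs hr hσ y)

lemma hasDerivAt_speedSq {z : ℝ} (hz : 0 < z) :
    HasDerivAt (speedSq r σ)
      (2 * (σ * (z + r * z ^ (-(2 * r) - 1)) + r * z ^ (-(2 * r) - 1))) z := by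
  have h := Real.hasDerivAt_rpow_const (x := z) (p := -(2 * r)) (Or.inl hz.ne')
  refine ((((hasDerivAt_pow 2 z).sub h).const_mul σ).add (h.const_sub 1)).congr_deriv ?_
  push_cast
  ring

lemma continuousAt_sign_mul_sqrt_speedSq (hr : 0 < r) (hσ : 0 ≤ σ) :
    ContinuousAt (fun y => SignType.sign y * √(speedSq r σ (profile r σ |y|))) 0 := by
  have h : Tendsto (fun y => √(speedSq r σ (profile r σ |y|))) (𝓝 0) (𝓝 0) := by
    have := (continuous_speedSq_profile_abs hr hσ).sqrt.tendsto 0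
    simpa [profile_zero hr hσ, speedSq_one] using this
  unfold ContinuousAt
  simp only [sign_zero, SignType.coe_zero, zero_mul]
  refine squeeze_zero_norm (fun y => ?_) h
  rw [norm_mul, Real.norm_of_nonneg (Real.sqrt_nonneg _)]
  refine mul_le_of_le_one_left (Real.sqrt_nonneg _) ?_
  rcases lt_trichotomy y 0 with h | h | h <;> simp [h]

/-- At the origin `|y|` has a corner, but the speed vanishes there; a continuous function whose
derivative off a point extends continuously is differentiable at that point. -/
lemma hasDerivAt_profile_abs (hr : 0 < r) (hσ : 0 ≤ σ) (y : ℝ) :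
    HasDerivAt (fun y => profile r σ |y|)
      (SignType.sign y * √(speedSq r σ (profile r σ |y|))) y :=
  hasDerivAt_of_hasDerivAt_of_ne' (x := 0)
    (g := fun y => SignType.sign y * √(speedSq r σ (profile r σ |y|)))
    (fun y hy => ((hasDerivAt_profile hr hσ (abs_pos.2 hy)).comp y (hasDerivAt_abs hy)).congr_deriv
      (mul_comm _ _))
    (continuous_profile_abs hr hσ).continuousAt (continuousAt_sign_mul_sqrt_speedSq hr hσ) y

lemma sq_sign_mul_sqrt_speedSq (hr : 0 < r) (hσ : 0 ≤ σ) (y : ℝ) :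
    (SignType.sign y * √(speedSq r σ (profile r σ |y|))) ^ 2 = speedSq r σ (profile r σ |y|) := by
  rw [mul_pow, Real.sq_sqrt (speedSq_nonneg hr hσ (one_le_profile_abs hr hσ y))]
  rcases lt_trichotomy y 0 with h | h | h <;> simp [h, profile_zero hr hσ, speedSq_one]

lemma continuous_acceleration_profile_abs (hr : 0 < r) (hσ : 0 ≤ σ) :
    Continuous fun y => σ * (profile r σ |y| + r * profile r σ |y| ^ (-(2 * r) - 1))
        + r * profile r σ |y| ^ (-(2 * r) - 1) := by
  have h := continuous_profile_abs hr hσ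
  have := h.rpow_const (p := -(2 * r) - 1)
    fun y => Or.inl (one_pos.trans_le (one_le_profile_abs hr hσ y)).ne'
  fun_prop

lemma hasDerivAt_sign_mul_sqrt_speedSq (hr : 0 < r) (hσ : 0 ≤ σ) (y : ℝ) :
    HasDerivAt (fun y => SignType.sign y * √(speedSq r σ (profile r σ |y|)))
      (σ * (profile r σ |y| + r * profile r σ |y| ^ (-(2 * r) - 1))
        + r * profile r σ |y| ^ (-(2 * r) - 1)) y := by
  refine hasDerivAt_of_hasDerivAt_of_ne' (x := 0)
    (g := fun y => σ * (profile r σ |y| + r * profile r σ |y| ^ (-(2 * r) - 1))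
        + r * profile r σ |y| ^ (-(2 * r) - 1)) (fun y hy => ?_)
    (continuousAt_sign_mul_sqrt_speedSq hr hσ)
    (continuous_acceleration_profile_abs hr hσ).continuousAt y
  · have h1 := one_lt_profile hr hσ (abs_pos.2 hy)
    have hD := speedSq_pos hr hσ h1
    have hc := (hasDerivAt_speedSq (r := r) (σ := σ) (one_pos.trans h1)).comp y
      (hasDerivAt_profile_abs hr hσ y)
    simp only [Function.comp_def] at hc
    have hd := (hc.sqrt hD.ne').const_mul (SignType.sign y : ℝ)
    refine (hd.congr_deriv ?_).congr_of_eventuallyEq ?_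
    · have hs : (SignType.sign y : ℝ) * SignType.sign y = 1 := by
        rcases hy.lt_or_gt with h | h <;> simp [h]
      have hD' := Real.sqrt_pos.2 hD
      field_simp
      rw [sq, hs]
    · have : ∀ᶠ x in 𝓝 y, SignType.sign x = SignType.sign y := by
        rcases hy.lt_or_gt with h | h
        · filter_upwards [Iio_mem_nhds h] with x hx
          rw [sign_neg h, sign_neg hx]
        · filter_upwards [Ioi_mem_nhds h] with x hx
          rw [sign_pos h, sign_pos hx]
      filter_upwards [this] with x hx
      rw [hx]

end EvenProfile

lemma contDiff_profile_abs {r σ : ℝ} (hr : 0 < r) (hσ : 0 ≤ σ) :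
    ContDiff ℝ 2 fun y => profile r σ |y| := by
  have h1 : deriv (fun y => profile r σ |y|) =
      fun y => SignType.sign y * √(speedSq r σ (profile r σ |y|)) :=
    funext fun y => (hasDerivAt_profile_abs hr hσ y).deriv
  have h2 := funext fun y => (hasDerivAt_sign_mul_sqrt_speedSq hr hσ y).deriv
  refine (contDiff_succ_iff_deriv (n := 1)).2
    ⟨fun y => (hasDerivAt_profile_abs hr hσ y).differentiableAt, by simp, ?_⟩
  rw [h1, contDiff_one_iff_deriv]
  refine ⟨fun y => (hasDerivAt_sign_mul_sqrt_speedSq hr hσ y).differentiableAt, ?_⟩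
  rw [h2]
  exact continuous_acceleration_profile_abs hr hσ

/-! ### Scaling relations and existence of the ground state -/

/-- The algebraic relations under which `x ↦ a V(κ |x|) ^ (-β)`, where `V` is the normalised profile
with parameters `r` and `σ`, is the ground state of frequency `ω`. -/
structure IsScaling (p q ω r β σ a κ : ℝ) : Prop where
  r_pos : 0 < r
  β_pos : 0 < β
  σ_nonneg : 0 ≤ σ
  a_pos : 0 < a
  κ_pos : 0 < κ
  mul_p : β * (p - 1) = 2
  mul_q : β * (q - 1) = 2 * r + 2
  amp_p : a ^ (p - 1) = β * (β + 1) * κ ^ 2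
  amp_q : a ^ (q - 1) = β * (β + 1 + r) * κ ^ 2 * (1 + σ)
  freq : ω = β ^ 2 * κ ^ 2 * σ

namespace IsScaling

variable {p q ω r β σ a κ : ℝ}

lemma rpow_p (h : IsScaling p q ω r β σ a κ) {z : ℝ} (hz : 0 < z) :
    (a * z ^ (-β)) ^ (p - 1) = β * (β + 1) * κ ^ 2 * (z ^ 2)⁻¹ := by
  rw [Real.mul_rpow h.a_pos.le (by positivity), h.amp_p, ← Real.rpow_mul hz.le, neg_mul, h.mul_p,
    Real.rpow_neg hz.le]
  norm_cast

lemma rpow_q (h : IsScaling p q ω r β σ a κ) {z : ℝ} (hz : 0 < z) :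
    (a * z ^ (-β)) ^ (q - 1) =
      β * (β + 1 + r) * κ ^ 2 * (1 + σ) * (z ^ (-(2 * r)) * (z ^ 2)⁻¹) := by
  rw [Real.mul_rpow h.a_pos.le (by positivity), h.amp_q, ← Real.rpow_mul hz.le, neg_mul, h.mul_q,
    neg_add, Real.rpow_add hz, Real.rpow_neg hz.le 2]
  norm_cast

lemma isGroundState (h : IsScaling p q ω r β σ a κ) :
    IsGroundState p q ω fun x => a * profile r σ |κ * x| ^ (-β) := by
  have hr := h.r_pos
  have hσ := h.σ_nonneg
  have hκ := h.κ_pos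
  have ha := h.a_pos
  have hβ := h.β_pos
  have hV : ∀ y, 0 < profile r σ |y| := fun y =>
    one_pos.trans_le (one_le_profile_abs hr hσ y)
  have hpos : ∀ x, 0 < a * profile r σ |κ * x| ^ (-β) := fun x =>
    mul_pos ha (Real.rpow_pos_of_pos (hV _) _)
  have hlin : ∀ x, HasDerivAt (fun x => κ * x) κ x := fun x => by
    simpa using (hasDerivAt_id x).const_mul κ
  have hE : ∀ x, HasDerivAt (fun x => profile r σ |κ * x|)
      (SignType.sign (κ * x) * √(speedSq r σ (profile r σ |κ * x|)) * κ) x := fun x =>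
    (hasDerivAt_profile_abs hr hσ (κ * x)).comp x (hlin x)
  have hE' : ∀ x, HasDerivAt
      (fun x => SignType.sign (κ * x) * √(speedSq r σ (profile r σ |κ * x|))) _ x :=
    fun x => (hasDerivAt_sign_mul_sqrt_speedSq hr hσ (κ * x)).comp x (hlin x)
  have hd1 : deriv (fun x => a * profile r σ |κ * x| ^ (-β)) = fun x =>
      a * ((SignType.sign (κ * x) * √(speedSq r σ (profile r σ |κ * x|))) * κ * (-β)
        * profile r σ |κ * x| ^ (-β - 1)) :=
    funext fun x => (((hE x).rpow_const (p := -β) (Or.inl (hV _).ne')).const_mul a).deriv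
  refine ⟨?_, fun x => ?_, hpos, fun x => by simp, ?_, ?_⟩
  · exact contDiff_const.mul (((contDiff_profile_abs hr hσ).comp
      (contDiff_const.mul contDiff_id)).rpow_const_of_ne fun x => (hV _).ne')
  · rw [hd1, ((((hE' x).mul_const κ).mul_const (-β)).fun_mul ((hE x).rpow_const (p := -β - 1)
      (Or.inl (hV _).ne')) |>.const_mul a).deriv, abs_of_pos (hpos x), h.rpow_p (hV _),
      h.rpow_q (hV _), h.freq]
    have hs := sq_sign_mul_sqrt_speedSq hr hσ (κ * x)
    have hz := hV (κ * x)
    set z := profile r σ |κ * x|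
    set S := (SignType.sign (κ * x) : ℝ) * √(speedSq r σ z)
    rw [Real.rpow_sub_one hz.ne' (-β - 1), Real.rpow_sub_one hz.ne', Real.rpow_sub_one hz.ne']
    rw [speedSq] at hs
    set w := z ^ (-(2 * r))
    set b := z ^ (-β)
    -- The velocity enters the equation only through its square, which is the explicit function
    -- `speedSq`; what remains is algebra in `z^(-β)` and `z^(-2r)`.
    have : S * κ * (-β) * (S * κ * (-β - 1) * (b / z / z)) =
      S ^ 2 * (κ ^ 2 * β * (β + 1) * (b / z / z)) := by ring
    rw [this, hs]
    field_simp
    ring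
  · intro x hx y hy hxy
    have hx : 0 ≤ x := hx
    have hy : 0 ≤ y := hy
    have hlt : profile r σ |κ * x| < profile r σ |κ * y| := by
      rw [abs_of_nonneg (by positivity), abs_of_nonneg (by positivity)]
      exact strictMonoOn_profile hr hσ (show 0 ≤ κ * x by positivity)
        (show 0 ≤ κ * y by positivity) (by gcongr)
    exact mul_lt_mul_of_pos_left (Real.rpow_lt_rpow_of_neg (hV _) hlt (by linarith)) ha
  · have h1 : Tendsto (fun x : ℝ => |κ * x|) (cocompact ℝ) atTop := by
      simp only [abs_mul, abs_of_pos hκ]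
      exact tendsto_norm_cocompact_atTop.const_mul_atTop hκ
    simpa using ((tendsto_rpow_neg_atTop hβ).comp
      ((tendsto_profile_atTop hr hσ).comp h1)).const_mul a

end IsScaling

/-! ### First integral and uniqueness of the ground state -/

namespace IsGroundState

variable {p q ω : ℝ} {φ : ℝ → ℝ}

lemma hasDerivAt (h : IsGroundState p q ω φ) (x : ℝ) : HasDerivAt φ (deriv φ x) x :=
  (h.contDiff.differentiable (by norm_num) x).hasDerivAt

lemma hasDerivAt_deriv (h : IsGroundState p q ω φ) (x : ℝ) :
    HasDerivAt (deriv φ) (ω * φ x + φ x ^ (p - 1) * φ x - φ x ^ (q - 1) * φ x) x := by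
  have h1 : ContDiff ℝ 1 (deriv φ) :=
    ((contDiff_succ_iff_deriv (n := 1)).1 h.contDiff).2.2
  have h2 := h.equation x
  rw [abs_of_pos (h.pos x)] at h2
  exact (h1.differentiable (by norm_num) x).hasDerivAt.congr_deriv (by linarith)

lemma deriv_zero (h : IsGroundState p q ω φ) : deriv φ 0 = 0 := by
  have h1 : (fun x => φ (-x)) = φ := funext h.even
  have h2 := deriv_comp_neg φ 0
  rw [h1, neg_zero] at h2
  linarith

lemma tendsto_atTop (h : IsGroundState p q ω φ) : Tendsto φ atTop (𝓝 0) :=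
  h.tendsto_zero.mono_left atTop_le_cocompact

/-- The first integral of the equation, at the energy level zero of the rest point. -/
lemma energy (h : IsGroundState p q ω φ) (hp : 1 < p) (hq : 1 < q) (x : ℝ) :
    deriv φ x ^ 2 = φ x ^ 2 *
      (ω + 2 / (p + 1) * φ x ^ (p - 1) - 2 / (q + 1) * φ x ^ (q - 1)) := by
  set H : ℝ → ℝ := fun x => deriv φ x ^ 2 - φ x ^ 2 *
      (ω + 2 / (p + 1) * φ x ^ (p - 1) - 2 / (q + 1) * φ x ^ (q - 1)) with hH
  have hd : ∀ x, HasDerivAt H 0 x := by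
    intro x
    have hx := (h.pos x).ne'
    have h1 := (h.hasDerivAt x).rpow_const (p := p - 1) (Or.inl hx)
    have h2 := (h.hasDerivAt x).rpow_const (p := q - 1) (Or.inl hx)
    refine (((h.hasDerivAt_deriv x).fun_pow 2).fun_sub (((h.hasDerivAt x).fun_pow 2).fun_mul
      (((h1.const_mul (2 / (p + 1))).const_add ω).fun_sub
        (h2.const_mul (2 / (q + 1)))))).congr_deriv ?_
    rw [Real.rpow_sub_one hx (p - 1), Real.rpow_sub_one hx (q - 1)]
    field_simp
    ring
  have hconst : ∀ y, H y = H x := fun y =>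
    is_const_of_deriv_eq_zero (fun y => (hd y).differentiableAt) (fun y => (hd y).deriv) y x
  -- Decay of `φ'` is not assumed. The mean value theorem on `[n, n+1]` gives points going to
  -- infinity along which `φ'` tends to zero, and this suffices to evaluate the constant energy.
  have hξ : ∀ n : ℕ, ∃ ξ : ℝ, (n : ℝ) < ξ ∧ deriv φ ξ = φ (n + 1) - φ n := by
    intro n
    obtain ⟨ξ, hξ, hs⟩ := exists_hasDerivAt_eq_slope φ (deriv φ)
      (show (n : ℝ) < n + 1 by linarith)
      (fun y _ => (h.hasDerivAt y).continuousAt.continuousWithinAt) fun y _ => h.hasDerivAt y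
    exact ⟨ξ, hξ.1, by rw [hs]; simp⟩
  choose ξ hξ1 hξ2 using hξ
  have hξ3 : Tendsto ξ atTop atTop :=
    tendsto_atTop_mono (fun n => (hξ1 n).le) tendsto_natCast_atTop_atTop
  have l1 : Tendsto (fun n => deriv φ (ξ n)) atTop (𝓝 0) := by
    simp only [hξ2]
    have a1 := h.tendsto_atTop.comp (tendsto_natCast_atTop_atTop (R := ℝ))
    have a2 := h.tendsto_atTop.comp
      (tendsto_atTop_add_const_right atTop (1 : ℝ) (tendsto_natCast_atTop_atTop (R := ℝ)))
    simpa using a2.sub a1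
  have l2 : Tendsto (fun n => φ (ξ n)) atTop (𝓝 0) := h.tendsto_atTop.comp hξ3
  have l3 : ∀ s : ℝ, 1 < s → Tendsto (fun n => φ (ξ n) ^ (s - 1)) atTop (𝓝 0) := by
    intro s hs
    have := l2.rpow_const (p := s - 1) (Or.inr (by linarith))
    rwa [Real.zero_rpow (by linarith)] at this
  have l4 : Tendsto (fun n => H (ξ n)) atTop (𝓝 0) := by
    have := (l1.pow 2).sub ((l2.pow 2).mul
      ((((l3 p hp).const_mul (2 / (p + 1))).const_add ω).sub ((l3 q hq).const_mul (2 / (q + 1)))))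
    simpa using this
  simp only [hconst] at l4
  have := tendsto_nhds_unique l4 tendsto_const_nhds
  simp only [hH] at this
  linarith

end IsGroundState

namespace IsScaling

variable {p q ω r β σ a κ : ℝ}

lemma one_lt_p (h : IsScaling p q ω r β σ a κ) : 1 < p := by
  have := h.mul_p
  have := h.β_pos
  nlinarith

lemma one_lt_q (h : IsScaling p q ω r β σ a κ) : 1 < q := by
  have := h.mul_q
  have := h.β_pos
  have := h.r_pos
  nlinarith

/-- The variable in which a ground state becomes the normalised profile. -/
lemma height_spec (h : IsScaling p q ω r β σ a κ) {φ : ℝ → ℝ} (hφ : IsGroundState p q ω φ)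
    {z : ℝ → ℝ} (hz : z = fun x => (φ x / a) ^ (-β⁻¹)) (x : ℝ) :
    0 < z x ∧ φ x = a * z x ^ (-β) ∧
      HasDerivAt z (-(β⁻¹ * z x * (deriv φ x / φ x))) x ∧
      (-(β⁻¹ * z x * (deriv φ x / φ x))) ^ 2 = κ ^ 2 * speedSq r σ (z x) := by
  have ha := h.a_pos
  have hβ := h.β_pos
  have hr := h.r_pos
  have hx := hφ.pos x
  have hxa : 0 < φ x / a := by positivity
  have hzpos : 0 < z x := by rw [hz]; positivity
  have hφz : φ x = a * z x ^ (-β) := by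
    simp only [hz]
    rw [← Real.rpow_mul hxa.le, neg_mul_neg, inv_mul_cancel₀ hβ.ne', Real.rpow_one]
    field_simp
  refine ⟨hzpos, hφz, ?_, ?_⟩
  · have := ((hφ.hasDerivAt x).div_const a).rpow_const (p := -β⁻¹) (Or.inl hxa.ne')
    rw [hz]
    refine this.congr_deriv ?_
    rw [Real.rpow_sub_one hxa.ne']
    field_simp
  · have hE := hφ.energy h.one_lt_p h.one_lt_q x
    have hp1 : p + 1 = 2 / β + 2 := by
      have := h.mul_p
      field_simp
      linarith
    have hq1 : q + 1 = (2 * r + 2) / β + 2 := by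
      have := h.mul_q
      field_simp
      linarith
    have e1 := h.rpow_p hzpos
    have e2 := h.rpow_q hzpos
    rw [← hφz] at e1 e2
    rw [e1, e2, h.freq, hp1, hq1] at hE
    rw [neg_sq, mul_pow, div_pow, hE, speedSq]
    set w := z x ^ (-(2 * r))
    have : β + 1 + r ≠ 0 := by positivity
    have : 2 * r + 2 + 2 * β ≠ 0 := by positivity
    field_simp
    ring

lemma eq_of_isGroundState (h : IsScaling p q ω r β σ a κ) {φ : ℝ → ℝ}
    (hφ : IsGroundState p q ω φ) : φ = fun x => a * profile r σ |κ * x| ^ (-β) := by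
  have ha := h.a_pos
  have hβ := h.β_pos
  have hr := h.r_pos
  have hσ := h.σ_nonneg
  have hκ := h.κ_pos
  obtain ⟨z, hz⟩ : ∃ z : ℝ → ℝ, z = fun x => (φ x / a) ^ (-β⁻¹) := ⟨_, rfl⟩
  have hs := h.height_spec hφ hz
  -- Evenness gives `φ'(0) = 0`, so the speed vanishes at height `z 0`; by strict monotonicity `1`
  -- is the only positive zero of `speedSq`.
  have hz0 : z 0 = 1 := by
    have h1 := (hs 0).2.2.2
    rw [hφ.deriv_zero] at h1
    have h2 : speedSq r σ (z 0) = speedSq r σ 1 := by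
      rw [speedSq_one]
      have : κ ^ 2 ≠ 0 := by positivity
      have h3 : κ ^ 2 * speedSq r σ (z 0) = 0 := by rw [← h1]; simp
      exact (mul_eq_zero.1 h3).resolve_left this
    exact (speedSq_strictMonoOn hr hσ).injOn (hs 0).1 (Set.mem_Ioi.2 one_pos) h2
  have hzmono : StrictMonoOn z (Set.Ici 0) := by
    intro x hx y hy hxy
    rw [hz]
    have := hφ.pos y
    exact Real.rpow_lt_rpow_of_neg (by positivity)
      (div_lt_div_of_pos_right (hφ.decreasing hx hy hxy) ha) (by simpa using hβ)
  have hz1 : ∀ x, 0 < x → 1 < z x := fun x hx => by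
    rw [← hz0]; exact hzmono Set.self_mem_Ici hx.le hx
  -- Monotonicity of `φ` selects the nonnegative square root of the first integral.
  have hzd : ∀ x, 0 < x → HasDerivAt z (κ * √(speedSq r σ (z x))) x := by
    intro x hx
    obtain ⟨h1, -, h3, h4⟩ := hs x
    have hD := speedSq_pos hr hσ (hz1 x hx)
    refine h3.congr_deriv ?_
    have h5 : deriv φ x ≤ 0 := by
      rw [← derivWithin_of_mem_nhds (Ici_mem_nhds hx)]
      exact hφ.decreasing.antitoneOn.derivWithin_nonpos
    have h6 : 0 ≤ -(β⁻¹ * z x * (deriv φ x / φ x)) := by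
      have := div_nonpos_of_nonpos_of_nonneg h5 (hφ.pos x).le
      have h7 : 0 ≤ β⁻¹ * z x := by positivity
      nlinarith
    rw [← Real.sqrt_sq h6, h4, Real.sqrt_mul (by positivity), Real.sqrt_sq hκ.le]
  have hzge : ∀ x, 0 ≤ x → 1 ≤ z x := fun x hx => by
    rcases hx.eq_or_lt with rfl | hx
    · exact hz0.ge
    · exact (hz1 x hx).le
  have hzc : Continuous z := continuous_iff_continuousAt.2 fun x => (hs x).2.2.1.continuousAt
  -- The equation for `z` is not Lipschitz at height `1`, so uniqueness is obtained by separating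
  -- variables: `T_σ(z(x))` has constant derivative `κ` for `x > 0` and vanishes at `0`.
  have hT : ∀ x, 0 ≤ x → travelTime r σ (z x) = κ * x := by
    intro x hx
    rcases hx.eq_or_lt with rfl | hx
    · simp [hz0]
    obtain ⟨c, hc, hs⟩ := exists_hasDerivAt_eq_slope (fun x => travelTime r σ (z x))
      (fun _ => κ) hx
      ((continuousOn_travelTime hr hσ).comp hzc.continuousOn fun y hy => hzge y hy.1)
      (fun y hy => by
        have h1 := hz1 y hy.1
        refine ((hasDerivAt_travelTime hr hσ h1).comp y (hzd y hy.1)).congr_deriv ?_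
        have := Real.sqrt_pos.2 (speedSq_pos hr hσ h1)
        unfold slowness
        field_simp)
    simp only [hz0, travelTime_one, sub_zero] at hs
    rw [hs]
    field_simp
  have hV : ∀ x, 0 ≤ x → φ x = a * profile r σ |κ * x| ^ (-β) := by
    intro x hx
    rw [abs_of_nonneg (by positivity), ← hT x hx, profile_travelTime hr hσ (hzge x hx)]
    exact (hs x).2.1
  funext x
  rcases le_total 0 x with hx | hx
  · exact hV x hx
  · rw [← hφ.even, hV (-x) (by linarith)]
    simp

lemma groundState_eq (h : IsScaling p q ω r β σ a κ) :
    groundState p q ω = fun x => a * profile r σ |κ * x| ^ (-β) :=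
  h.eq_of_isGroundState (Classical.epsilon_spec ⟨_, h.isGroundState⟩)

lemma existsUnique (h : IsScaling p q ω r β σ a κ) : ∃! φ, IsGroundState p q ω φ :=
  ⟨_, h.isGroundState, fun _ => h.eq_of_isGroundState⟩

end IsScaling

/-! ### Change of variables from position to height -/

section ChangeOfVariables

variable {r σ : ℝ}

lemma image_travelTime_Ioi (hr : 0 < r) (hσ : 0 ≤ σ) :
    travelTime r σ '' Set.Ioi 1 = Set.Ioi 0 := by
  ext y
  constructor
  · rintro ⟨z, hz, rfl⟩
    have := strictMonoOn_travelTime hr hσ Set.self_mem_Ici (Set.mem_Ici.2 (le_of_lt hz)) hz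
    simpa using this
  · exact fun hy => ⟨profile r σ y, one_lt_profile hr hσ hy,
      travelTime_profile hr hσ (le_of_lt hy)⟩

lemma injOn_travelTime_Ioi (hr : 0 < r) (hσ : 0 ≤ σ) :
    Set.InjOn (travelTime r σ) (Set.Ioi 1) :=
  (strictMonoOn_travelTime hr hσ).injOn.mono Set.Ioi_subset_Ici_self

lemma integrableOn_comp_profile_iff (hr : 0 < r) (hσ : 0 ≤ σ) (G : ℝ → ℝ) :
    IntegrableOn (fun y => G (profile r σ y)) (Set.Ioi 0) ↔
      IntegrableOn (fun z => G z * slowness r σ z) (Set.Ioi 1) := by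
  rw [← image_travelTime_Ioi hr hσ, integrableOn_image_iff_integrableOn_abs_deriv_smul
    measurableSet_Ioi (fun z hz => (hasDerivAt_travelTime hr hσ hz).hasDerivWithinAt)
    (injOn_travelTime_Ioi hr hσ)]
  refine integrableOn_congr_fun (fun z hz => ?_) measurableSet_Ioi
  rw [profile_travelTime hr hσ (le_of_lt hz), abs_of_nonneg slowness_nonneg, smul_eq_mul, mul_comm]

lemma integral_comp_profile (hr : 0 < r) (hσ : 0 ≤ σ) (G : ℝ → ℝ) :
    ∫ y in Set.Ioi 0, G (profile r σ y) = ∫ z in Set.Ioi 1, G z * slowness r σ z := by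
  rw [← image_travelTime_Ioi hr hσ, integral_image_eq_integral_abs_deriv_smul
    measurableSet_Ioi (fun z hz => (hasDerivAt_travelTime hr hσ hz).hasDerivWithinAt)
    (injOn_travelTime_Ioi hr hσ)]
  refine setIntegral_congr_fun measurableSet_Ioi (fun z hz => ?_)
  rw [profile_travelTime hr hσ (le_of_lt hz), abs_of_nonneg slowness_nonneg, smul_eq_mul, mul_comm]

lemma integrable_comp_abs_iff {f : ℝ → ℝ} :
    Integrable (fun x => f |x|) ↔ IntegrableOn f (Set.Ioi 0) := by
  have h1 : IntegrableOn (fun x => f |x|) (Set.Ioi 0) ↔ IntegrableOn f (Set.Ioi 0) :=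
    integrableOn_congr_fun (fun x hx => by rw [abs_of_pos hx]) measurableSet_Ioi
  refine ⟨fun h => h1.1 h.integrableOn, fun h => ?_⟩
  have h2 : IntegrableOn (fun x => f |x|) (Set.Iic 0) := by
    have hneg : MeasurableEmbedding fun x : ℝ => -x :=
      (Homeomorph.neg ℝ).isClosedEmbedding.measurableEmbedding
    rw [← Measure.map_neg_eq_self (volume : Measure ℝ), hneg.integrableOn_map_iff]
    simp only [Function.comp_def, abs_neg, Set.neg_preimage, Set.neg_Iic,
      neg_zero]
    exact Iff.mpr integrableOn_Ici_iff_integrableOn_Ioi (h1.2 h)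
  rw [← integrableOn_univ, ← Set.Iic_union_Ioi (a := (0 : ℝ))]
  exact h2.union (h1.2 h)

lemma integrable_comp_profile_abs_iff (hr : 0 < r) (hσ : 0 ≤ σ) {κ : ℝ} (hκ : 0 < κ)
    (G : ℝ → ℝ) : Integrable (fun x => G (profile r σ |κ * x|)) ↔
      IntegrableOn (fun z => G z * slowness r σ z) (Set.Ioi 1) := by
  rw [integrable_comp_mul_left_iff (fun y => G (profile r σ |y|)) hκ.ne',
    integrable_comp_abs_iff (f := fun y => G (profile r σ y)), integrableOn_comp_profile_iff hr hσ]

lemma integral_comp_profile_abs (hr : 0 < r) (hσ : 0 ≤ σ) {κ : ℝ} (hκ : 0 < κ) (G : ℝ → ℝ) :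
    ∫ x, G (profile r σ |κ * x|) = 2 / κ * ∫ z in Set.Ioi 1, G z * slowness r σ z := by
  rw [Measure.integral_comp_mul_left (fun y => G (profile r σ |y|)),
    integral_comp_abs (f := fun y => G (profile r σ y)), integral_comp_profile hr hσ,
    abs_of_pos (by positivity), smul_eq_mul]
  ring

end ChangeOfVariables

/-! ### Weighted integrals of primitives by Tonelli -/

section Tonelli

variable {m : ℝ} {f : ℝ → ℝ}

lemma integrableOn_Ioi_rpow_neg_sub_one (hm : 0 < m) {t : ℝ} (ht : 0 < t) :
    IntegrableOn (fun z : ℝ => z ^ (-m - 1)) (Set.Ioi t) :=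
  integrableOn_Ioi_rpow_of_lt (by linarith) ht

/-- Exchange the order of integration over `1 < t ≤ z` and use `∫_t^∞ z^(-m-1) dz = t^(-m)/m`.
Working in `[0, ∞]` yields both the equivalence of integrability and the value of the integral. -/
lemma lintegral_rpow_mul_primitive (hm : 0 < m) (hf : Measurable f)
    (hf0 : ∀ t, 1 < t → 0 ≤ f t) (hfi : ∀ z, 1 ≤ z → IntervalIntegrable f volume 1 z) :
    ∫⁻ z in Set.Ioi 1, ENNReal.ofReal (z ^ (-m - 1) * ∫ t in (1 : ℝ)..z, f t) =
      ∫⁻ t in Set.Ioi 1, ENNReal.ofReal (m⁻¹ * (t ^ (-m) * f t)) := by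
  set K : ℝ → ℝ → ENNReal := fun z t =>
    {x : ℝ × ℝ | x.2 ≤ x.1}.indicator (fun x => ENNReal.ofReal (x.1 ^ (-m - 1) * f x.2)) (z, t)
    with hK
  have hmeas : Measurable (Function.uncurry K) := by
    have : Function.uncurry K = {x : ℝ × ℝ | x.2 ≤ x.1}.indicator
      (fun x => ENNReal.ofReal (x.1 ^ (-m - 1) * f x.2)) := rfl
    rw [this]
    exact Measurable.indicator (by fun_prop) (measurableSet_le measurable_snd measurable_fst)
  have h1 : ∀ z ∈ Set.Ioi (1 : ℝ), ENNReal.ofReal (z ^ (-m - 1) * ∫ t in (1 : ℝ)..z, f t) =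
      ∫⁻ t in Set.Ioi 1, K z t := by
    intro z hz
    have hz1 : (1 : ℝ) < z := hz
    have hz0 : (0 : ℝ) < z := by linarith
    have : ∀ t, K z t = (Set.Iic z).indicator
        (fun t => ENNReal.ofReal (z ^ (-m - 1) * f t)) t := fun t => by
      simp [hK, Set.indicator_apply]
    simp only [this]
    rw [lintegral_indicator measurableSet_Iic, Measure.restrict_restrict measurableSet_Iic,
      Set.inter_comm, Set.Ioi_inter_Iic, ← intervalIntegral.integral_const_mul,
      intervalIntegral.integral_of_le hz1.le]
    refine ofReal_integral_eq_lintegral_ofReal ?_ ?_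
    · exact ((hfi z hz1.le).const_mul _).1
    · refine (ae_restrict_mem measurableSet_Ioc).mono fun t ht => ?_
      have := hf0 t ht.1
      simp only [Pi.zero_apply]
      positivity
  have h2 : ∀ t ∈ Set.Ioi (1 : ℝ), ∫⁻ z in Set.Ioi 1, K z t =
      ENNReal.ofReal (m⁻¹ * (t ^ (-m) * f t)) := by
    intro t ht
    have ht1 : (1 : ℝ) < t := ht
    have ht0 : (0 : ℝ) < t := by linarith
    have hft := hf0 t ht
    have : ∀ z, K z t = (Set.Ici t).indicator
        (fun z => ENNReal.ofReal (z ^ (-m - 1) * f t)) z := fun z => by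
      simp [hK, Set.indicator_apply]
    simp only [this]
    rw [lintegral_indicator measurableSet_Ici, Measure.restrict_restrict measurableSet_Ici,
      Set.inter_eq_left.2 (Set.Ici_subset_Ioi.2 ht1),
      ← Measure.restrict_congr_set (Ioi_ae_eq_Ici (μ := volume) (a := t)),
      ← ofReal_integral_eq_lintegral_ofReal
        ((integrableOn_Ioi_rpow_neg_sub_one hm ht0).mul_const _), integral_mul_const,
      integral_Ioi_rpow_of_lt (by linarith) ht0]
    · congr 1
      rw [sub_add_cancel]
      field_simp
    · refine (ae_restrict_mem measurableSet_Ioi).mono fun z hz => ?_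
      have : 0 < z := ht0.trans hz
      simp only [Pi.zero_apply]
      positivity
  rw [setLIntegral_congr_fun measurableSet_Ioi h1, lintegral_lintegral_swap hmeas.aemeasurable,
    setLIntegral_congr_fun measurableSet_Ioi h2]

lemma aestronglyMeasurable_rpow_mul_primitive
    (hfi : ∀ z, 1 ≤ z → IntervalIntegrable f volume 1 z) :
    AEStronglyMeasurable (fun z : ℝ => z ^ (-m - 1) * ∫ t in (1 : ℝ)..z, f t)
      (volume.restrict (Set.Ioi 1)) := by
  refine AEStronglyMeasurable.mul (by fun_prop) ?_
  exact ((continuousOn_primitive_Ici hfi).mono Set.Ioi_subset_Ici_self).aestronglyMeasurable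
    measurableSet_Ioi

lemma rpow_mul_primitive_nonneg (hf0 : ∀ t, 1 < t → 0 ≤ f t) :
    0 ≤ᵐ[volume.restrict (Set.Ioi 1)] fun z : ℝ => z ^ (-m - 1) * ∫ t in (1 : ℝ)..z, f t := by
  refine (ae_restrict_mem measurableSet_Ioi).mono fun z hz => ?_
  have : (0 : ℝ) < z := one_pos.trans hz
  have : 0 ≤ ∫ t in (1 : ℝ)..z, f t := by
    rw [intervalIntegral.integral_of_le (le_of_lt hz)]
    exact setIntegral_nonneg measurableSet_Ioc fun t ht => hf0 t ht.1
  simp only [Pi.zero_apply]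
  positivity

lemma rpow_mul_nonneg (hm : 0 < m) (hf0 : ∀ t, 1 < t → 0 ≤ f t) :
    0 ≤ᵐ[volume.restrict (Set.Ioi 1)] fun t : ℝ => m⁻¹ * (t ^ (-m) * f t) := by
  refine (ae_restrict_mem measurableSet_Ioi).mono fun z hz => ?_
  have : (0 : ℝ) < z := one_pos.trans hz
  have := hf0 z hz
  simp only [Pi.zero_apply]
  positivity

lemma integrableOn_rpow_mul_primitive_iff (hm : 0 < m) (hf : Measurable f)
    (hf0 : ∀ t, 1 < t → 0 ≤ f t) (hfi : ∀ z, 1 ≤ z → IntervalIntegrable f volume 1 z) :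
    IntegrableOn (fun z : ℝ => z ^ (-m - 1) * ∫ t in (1 : ℝ)..z, f t) (Set.Ioi 1) ↔
      IntegrableOn (fun t => t ^ (-m) * f t) (Set.Ioi 1) := by
  rw [IntegrableOn, ← lintegral_ofReal_ne_top_iff_integrable
    (aestronglyMeasurable_rpow_mul_primitive hfi) (rpow_mul_primitive_nonneg hf0),
    lintegral_rpow_mul_primitive hm hf hf0 hfi,
    lintegral_ofReal_ne_top_iff_integrable (by fun_prop) (rpow_mul_nonneg hm hf0),
    integrable_const_mul_iff (by simpa using hm.ne'), IntegrableOn]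

lemma integral_rpow_mul_primitive (hm : 0 < m) (hf : Measurable f)
    (hf0 : ∀ t, 1 < t → 0 ≤ f t) (hfi : ∀ z, 1 ≤ z → IntervalIntegrable f volume 1 z) :
    ∫ z in Set.Ioi 1, z ^ (-m - 1) * ∫ t in (1 : ℝ)..z, f t =
      m⁻¹ * ∫ t in Set.Ioi 1, t ^ (-m) * f t := by
  rw [← integral_const_mul, integral_eq_lintegral_of_nonneg_ae (rpow_mul_primitive_nonneg hf0)
    (aestronglyMeasurable_rpow_mul_primitive hfi), lintegral_rpow_mul_primitive hm hf hf0 hfi,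
    integral_eq_lintegral_of_nonneg_ae (rpow_mul_nonneg hm hf0) (by fun_prop)]

end Tonelli

/-! ### The mass integral and its derivative as `σ` tends to zero -/

section MassIntegral

/-- Half the integral over the line of the power `-m` of the even normalised profile. -/
noncomputable def massIntegral (r m σ : ℝ) : ℝ := ∫ z in Set.Ioi 1, z ^ (-m) * slowness r σ z

/-- Minus the derivative of `massIntegral r m σ` in `σ`. -/
noncomputable def massIntegralVar (r m σ : ℝ) : ℝ :=
  ∫ z in Set.Ioi 1, z ^ (-m) * slownessVar r σ z

variable {r m σ : ℝ}

lemma hasDerivAt_massIntegral (hr : 0 < r) (hm : 0 < m) (hσ : 0 < σ) :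
    HasDerivAt (massIntegral r m) (-massIntegralVar r m σ) σ := by
  -- On `s > σ/2` the slowness at `σ/2` dominates, with constant `(2s)⁻¹ ≤ σ⁻¹`. Differentiability
  -- for `σ > 0` thus needs no condition beyond `m > 0`.
  have hσ2 : 0 < σ / 2 := by positivity
  have := (hasDerivAt_integral_of_dominated_loc_of_deriv_le
    (μ := volume.restrict (Set.Ioi (1 : ℝ)))
    (F := fun s z => z ^ (-m) * slowness r s z) (F' := fun s z => -(z ^ (-m) * slownessVar r s z))
    (x₀ := σ) (s := Set.Ioi (σ / 2)) (bound := fun z => σ⁻¹ * (z ^ (-m) * slowness r (σ / 2) z))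
    (Ioi_mem_nhds (by linarith)) (Eventually.of_forall fun _ => by fun_prop)
    (integrableOn_rpow_mul_slowness hr hσ hm) (by fun_prop)
    ((ae_restrict_mem measurableSet_Ioi).mono fun z hz s hs => ?_)
    ((integrableOn_rpow_mul_slowness hr hσ2 hm).const_mul _)
    ((ae_restrict_mem measurableSet_Ioi).mono fun z hz s hs => ?_)).2
  · rwa [integral_neg] at this
  · have hz0 : (0 : ℝ) < z := one_pos.trans hz
    have hs' : σ / 2 < s := hs
    have hs0 : 0 < s := hσ2.trans hs
    have h1 := slownessVar_le_div hr hs0 hz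
    have h2 := slowness_antitoneOn hr hz (Set.mem_Ici.2 hσ2.le) (Set.mem_Ici.2 hs0.le)
      (le_of_lt hs)
    have h3 := slownessVar_nonneg (σ := s) hr (le_of_lt hz)
    rw [norm_neg, Real.norm_of_nonneg (by positivity)]
    have h4 : (2 * s)⁻¹ ≤ σ⁻¹ := inv_anti₀ hσ (by linarith)
    have h5 := slowness_nonneg (r := r) (σ := s) (z := z)
    simp only at h2
    calc z ^ (-m) * slownessVar r s z ≤ z ^ (-m) * (σ⁻¹ * slowness r (σ / 2) z) := by
          gcongr
          exact h1.trans (by gcongr)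
      _ = _ := by ring
  · have h1 := hasDerivAt_slowness_param hr (hσ2.le.trans (le_of_lt hs)) hz
    simpa using h1.const_mul (z ^ (-m))

lemma integrableOn_rpow_mul_slownessVar (hr : 0 < r) (hm : 3 < m) (hσ : 0 ≤ σ) :
    IntegrableOn (fun z => z ^ (-m) * slownessVar r σ z) (Set.Ioi 1) ∧
      ∀ z, 1 < z → ‖z ^ (-m) * slownessVar r σ z‖ ≤
        (2 + r⁻¹) / 2 * (z ^ (-(m - 2)) * slowness r 0 z) := by
  have hb : ∀ z, 1 < z → ‖z ^ (-m) * slownessVar r σ z‖ ≤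
      (2 + r⁻¹) / 2 * (z ^ (-(m - 2)) * slowness r 0 z) := by
    intro z hz
    have hz0 : (0 : ℝ) < z := one_pos.trans hz
    have h1 := slownessVar_le hr hσ hz
    have h2 := slownessVar_nonneg (σ := σ) hr hz.le
    have h3 : z ^ (-(m - 2)) = z ^ (-m) * z ^ 2 := by
      rw [neg_sub, sub_eq_neg_add, Real.rpow_add hz0]
      norm_cast
    rw [Real.norm_of_nonneg (by positivity), h3]
    calc _ ≤ z ^ (-m) * ((2 + r⁻¹) / 2 * (z ^ 2 * slowness r 0 z)) := by gcongr
      _ = _ := by ring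
  refine ⟨((integrableOn_rpow_mul_slowness_zero hr (s := m - 2) (by linarith)).const_mul
    ((2 + r⁻¹) / 2)).mono' (by fun_prop) ?_, hb⟩
  exact (ae_restrict_mem measurableSet_Ioi).mono hb

lemma tendsto_massIntegralVar (hr : 0 < r) (hm : 3 < m) :
    Tendsto (massIntegralVar r m) (𝓝[>] 0) (𝓝 (massIntegralVar r m 0)) := by
  refine tendsto_integral_filter_of_dominated_convergence
    (fun z => (2 + r⁻¹) / 2 * (z ^ (-(m - 2)) * slowness r 0 z))
    (Eventually.of_forall fun _ => by fun_prop) ?_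
    ((integrableOn_rpow_mul_slowness_zero hr (s := m - 2) (by linarith)).const_mul _) ?_
  · filter_upwards [self_mem_nhdsWithin] with s hs
    exact (ae_restrict_mem measurableSet_Ioi).mono
      (integrableOn_rpow_mul_slownessVar hr hm (le_of_lt hs)).2
  · exact (ae_restrict_mem measurableSet_Ioi).mono fun z hz =>
      (continuousWithinAt_slownessVar_param hr le_rfl hz _).tendsto.const_mul _

lemma tendsto_massIntegral (hr : 0 < r) (hm : 1 < m) :
    Tendsto (massIntegral r m) (𝓝[>] 0) (𝓝 (massIntegral r m 0)) := by
  refine tendsto_integral_filter_of_dominated_convergence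
    (fun z => z ^ (-m) * slowness r 0 z)
    (Eventually.of_forall fun _ => by fun_prop) ?_
    (integrableOn_rpow_mul_slowness_zero hr hm) ?_
  · filter_upwards [self_mem_nhdsWithin] with s hs
    refine (ae_restrict_mem measurableSet_Ioi).mono fun z hz => ?_
    have hz0 : (0 : ℝ) < z := one_pos.trans hz
    have := slowness_nonneg (r := r) (σ := s) (z := z)
    rw [Real.norm_of_nonneg (by positivity)]
    gcongr
    exact slowness_le hr (le_of_lt hs) hz
  · exact (ae_restrict_mem measurableSet_Ioi).mono fun z hz =>
      ((hasDerivAt_slowness_param hr le_rfl hz).continuousAt.continuousWithinAt).tendsto.const_mul _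

lemma massIntegral_nonneg : 0 ≤ massIntegral r m σ :=
  setIntegral_nonneg measurableSet_Ioi fun z hz => by
    have hz0 : (0 : ℝ) < z := one_pos.trans hz
    have := slowness_nonneg (r := r) (σ := σ) (z := z)
    positivity

/-- While `σ z² ≤ 1` the squared speed is at most `2`, so `slowness³ ≥ 1/8`; for `z ≥ 2` the
numerator contributes `z²/4`. At `m ≤ 3` the product decays no faster than `1/z`. -/
lemma le_rpow_mul_slownessVar (hr : 0 < r) (hm : m ≤ 3) (hσ : 0 ≤ σ) {z : ℝ} (hz : 2 ≤ z)
    (hσz : σ * z ^ 2 ≤ 1) : 1 / 32 * z⁻¹ ≤ z ^ (-m) * slownessVar r σ z := by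
  have hz1 : 1 < z := by linarith
  have hz0 : 0 < z := by linarith
  have hF : 1 / 2 ≤ slowness r σ z := by
    have h1 := speedSq_le_add (r := r) hσ hz1.le
    have h2 := speedSq_pos hr hσ hz1
    rw [one_div]
    exact inv_anti₀ (by positivity) (Real.sqrt_le_iff.2 ⟨by norm_num, by linarith⟩)
  have hF3 : 1 / 8 ≤ slowness r σ z ^ 3 := by
    calc (1 / 8 : ℝ) = (1 / 2) ^ 3 := by norm_num
      _ ≤ _ := by gcongr
  have hw : z ^ 2 / 4 ≤ (z ^ 2 - z ^ (-(2 * r))) / 2 := by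
    have := weight_le_one hr hz1.le
    nlinarith
  have hzm : (z ^ 3)⁻¹ ≤ z ^ (-m) := by
    rw [← Real.rpow_natCast, ← Real.rpow_neg hz0.le]
    exact Real.rpow_le_rpow_of_exponent_le hz1.le (by push_cast; linarith)
  calc 1 / 32 * z⁻¹ = (z ^ 3)⁻¹ * (z ^ 2 / 4 * (1 / 8)) := by field_simp; norm_num
    _ ≤ z ^ (-m) * slownessVar r σ z :=
        mul_le_mul hzm (mul_le_mul hw hF3 (by norm_num) ((by positivity : 0 ≤ z ^ 2 / 4).trans hw))
          (by positivity) (by positivity)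

lemma not_integrableOn_rpow_mul_slownessVar_zero (hr : 0 < r) (hm : m ≤ 3) :
    ¬ IntegrableOn (fun z => z ^ (-m) * slownessVar r 0 z) (Set.Ioi 1) := by
  intro h
  have h2 := h.mono_set (Set.Ioi_subset_Ioi (one_le_two : (1 : ℝ) ≤ 2))
  refine not_integrableOn_Ioi_inv (a := (2 : ℝ)) ?_
  refine (h2.const_mul 32).mono' (by fun_prop) ?_
  refine (ae_restrict_mem measurableSet_Ioi).mono fun z hz => ?_
  have hz2 : 2 < z := hz
  have := le_rpow_mul_slownessVar hr hm le_rfl hz2.le (by simp)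
  rw [Real.norm_of_nonneg (by positivity)]
  linarith

/-- The `1/z` lower bound holds up to height `σ^(-1/2)`, so the integral is at least a multiple of
`log (σ^(-1/2) / 2)`. -/
lemma tendsto_massIntegralVar_atTop (hr : 0 < r) (hm0 : 0 < m) (hm : m ≤ 3) :
    Tendsto (massIntegralVar r m) (𝓝[>] 0) atTop := by
  have hR : Tendsto (fun s : ℝ => (√s)⁻¹) (𝓝[>] 0) atTop := by
    refine tendsto_inv_nhdsGT_zero.comp (tendsto_nhdsWithin_iff.2 ⟨?_, ?_⟩)
    · simpa using (Real.continuous_sqrt.tendsto 0).mono_left nhdsWithin_le_nhds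
    · filter_upwards [self_mem_nhdsWithin] with s hs using Real.sqrt_pos.2 hs
  have hlog : Tendsto (fun s : ℝ => 1 / 32 * Real.log ((√s)⁻¹ / 2)) (𝓝[>] 0) atTop :=
    (Real.tendsto_log_atTop.comp (hR.atTop_div_const two_pos)).const_mul_atTop (by norm_num)
  refine tendsto_atTop_mono' _ ?_ hlog
  filter_upwards [self_mem_nhdsWithin, hR.eventually_ge_atTop 2] with s hs hs2
  have hs : 0 < s := hs
  have h02 : (0 : ℝ) ∉ Set.uIcc 2 (√s)⁻¹ := by
    rw [Set.uIcc_of_le hs2]; intro h; linarith [h.1]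
  have hint : IntegrableOn (fun z => z ^ (-m) * slownessVar r s z) (Set.Ioi 1) := by
    refine ((integrableOn_rpow_mul_slowness hr hs hm0).const_mul (2 * s)⁻¹).mono'
      (by fun_prop) ?_
    refine (ae_restrict_mem measurableSet_Ioi).mono fun z hz => ?_
    have hz0 : (0 : ℝ) < z := one_pos.trans hz
    have h1 := slownessVar_le_div hr hs hz
    have h3 := slownessVar_nonneg (σ := s) hr (le_of_lt hz)
    rw [Real.norm_of_nonneg (by positivity)]
    calc _ ≤ z ^ (-m) * ((2 * s)⁻¹ * slowness r s z) := by gcongr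
      _ = _ := by ring
  have hsub : Set.Ioc 2 (√s)⁻¹ ⊆ Set.Ioi (1 : ℝ) := fun z hz => one_lt_two.trans hz.1
  calc 1 / 32 * Real.log ((√s)⁻¹ / 2) = ∫ z in Set.Ioc 2 (√s)⁻¹, 1 / 32 * z⁻¹ := by
        rw [← intervalIntegral.integral_of_le hs2, intervalIntegral.integral_const_mul,
          integral_inv h02]
    _ ≤ ∫ z in Set.Ioc 2 (√s)⁻¹, z ^ (-m) * slownessVar r s z := by
        refine setIntegral_mono_on ?_ (hint.mono_set hsub) measurableSet_Ioc fun z hz => ?_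
        · exact (((intervalIntegrable_inv_iff.2 (Or.inr h02)).const_mul _)).1
        · refine le_rpow_mul_slownessVar hr hm hs.le hz.1.le ?_
          have hz0 : 0 < z := two_pos.trans hz.1
          calc s * z ^ 2 ≤ s * ((√s)⁻¹) ^ 2 := by gcongr; exact hz.2
            _ = 1 := by rw [inv_pow, Real.sq_sqrt hs.le, mul_inv_cancel₀ hs.ne']
    _ ≤ massIntegralVar r m s := by
        refine setIntegral_mono_set hint ?_ hsub.eventuallyLE
        refine (ae_restrict_mem measurableSet_Ioi).mono fun z hz => ?_
        have hz0 : (0 : ℝ) < z := one_pos.trans hz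
        have h3 := slownessVar_nonneg (σ := s) hr (le_of_lt hz)
        simp only [Pi.zero_apply]
        positivity

end MassIntegral

/-! ### The frequency as a function of the parameter, and its inverse -/

section Frequency

lemma continuousOn_invFunOn_Ici {f : ℝ → ℝ} {a : ℝ} (hf : ContinuousOn f (Set.Ici a))
    (hm : StrictMonoOn f (Set.Ici a)) (ht : Tendsto f atTop atTop) :
    ContinuousOn (Function.invFunOn f (Set.Ici a)) (Set.Ici (f a)) := by
  have hs := surjOn_Ici_of_tendsto_atTop hf ht
  set g := Function.invFunOn f (Set.Ici a)
  have hg : ∀ y, f a ≤ y → a ≤ g y := fun y hy => Function.invFunOn_mem (hs hy)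
  have hfg : ∀ y, f a ≤ y → f (g y) = y := fun y hy => Function.invFunOn_eq (hs hy)
  intro y hy
  have hy : f a ≤ y := hy
  refine tendsto_order.2 ⟨fun l hl => ?_, fun u hu => ?_⟩
  · rcases lt_or_ge l a with h | h
    · filter_upwards [self_mem_nhdsWithin] with x hx using h.trans_le (hg x hx)
    · have h1 : f l < y := by rw [← hfg y hy]; exact hm h (hg y hy) hl
      filter_upwards [self_mem_nhdsWithin, mem_nhdsWithin_of_mem_nhds (Ioi_mem_nhds h1)]
        with x hx hx1
      rw [← hm.lt_iff_lt h (hg x hx), hfg x hx]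
      exact hx1
  · have h : a ≤ u := (hg y hy).trans (le_of_lt hu)
    have h1 : y < f u := by rw [← hfg y hy]; exact hm (hg y hy) h hu
    filter_upwards [self_mem_nhdsWithin, mem_nhdsWithin_of_mem_nhds (Iio_mem_nhds h1)]
      with x hx hx1
    rw [← hm.lt_iff_lt (hg x hx) h, hfg x hx]
    exact hx1

/-- The frequency of the ground state built from the normalised profile of parameter `σ`. -/
noncomputable def frequency (r c σ : ℝ) : ℝ := c * (σ * (1 + σ) ^ r⁻¹)

/-- The derivative of `frequency r c`. -/
noncomputable def frequencyDeriv (r c σ : ℝ) : ℝ :=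
  c * ((1 + σ) ^ r⁻¹ + σ * (r⁻¹ * (1 + σ) ^ (r⁻¹ - 1)))

/-- The inverse of `frequency r c` on `[0, ∞)`. -/
noncomputable def parameter (r c ω : ℝ) : ℝ := Function.invFunOn (frequency r c) (Set.Ici 0) ω

variable {r c σ ω : ℝ}

lemma hasDerivAt_one_add_rpow (hσ : 0 ≤ σ) (s : ℝ) :
    HasDerivAt (fun x : ℝ => (1 + x) ^ s) (s * (1 + σ) ^ (s - 1)) σ := by
  simpa using ((hasDerivAt_id σ).const_add 1).rpow_const (p := s)
    (Or.inl (by simp only [id]; positivity))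

lemma hasDerivAt_frequency (hσ : 0 ≤ σ) :
    HasDerivAt (frequency r c) (frequencyDeriv r c σ) σ := by
  refine (((hasDerivAt_id σ).fun_mul (hasDerivAt_one_add_rpow hσ r⁻¹)).const_mul c).congr_deriv ?_
  simp [frequencyDeriv]

lemma frequencyDeriv_pos (hr : 0 < r) (hc : 0 < c) (hσ : 0 ≤ σ) : 0 < frequencyDeriv r c σ := by
  unfold frequencyDeriv; positivity

lemma strictMonoOn_frequency (hr : 0 < r) (hc : 0 < c) :
    StrictMonoOn (frequency r c) (Set.Ici 0) := by
  intro x hx y hy hxy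
  have hx : 0 ≤ x := hx
  have hy : 0 ≤ y := hy
  unfold frequency
  gcongr

lemma tendsto_frequency (hr : 0 < r) (hc : 0 < c) : Tendsto (frequency r c) atTop atTop := by
  refine tendsto_atTop_mono' _ ?_ (tendsto_id.const_mul_atTop hc)
  filter_upwards [eventually_ge_atTop 0] with s hs
  refine mul_le_mul_of_nonneg_left (le_mul_of_one_le_right hs ?_) hc.le
  exact Real.one_le_rpow (by linarith) (by positivity)

lemma continuousOn_frequency : ContinuousOn (frequency r c) (Set.Ici 0) :=
  fun _ hx => (hasDerivAt_frequency hx).continuousAt.continuousWithinAt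

lemma frequency_zero : frequency r c 0 = 0 := by simp [frequency]

lemma surjOn_frequency (hr : 0 < r) (hc : 0 < c) :
    Set.SurjOn (frequency r c) (Set.Ici 0) (Set.Ici 0) := by
  simpa [frequency_zero] using surjOn_Ici_of_tendsto_atTop continuousOn_frequency
    (tendsto_frequency hr hc)

lemma parameter_nonneg (hr : 0 < r) (hc : 0 < c) (hω : 0 ≤ ω) : 0 ≤ parameter r c ω :=
  Function.invFunOn_mem (surjOn_frequency hr hc hω)

lemma frequency_parameter (hr : 0 < r) (hc : 0 < c) (hω : 0 ≤ ω) :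
    frequency r c (parameter r c ω) = ω :=
  Function.invFunOn_eq (surjOn_frequency hr hc hω)

lemma parameter_zero (hr : 0 < r) (hc : 0 < c) : parameter r c 0 = 0 :=
  (strictMonoOn_frequency hr hc).injOn (parameter_nonneg hr hc le_rfl) Set.self_mem_Ici
    (by rw [frequency_parameter hr hc le_rfl, frequency_zero])

lemma parameter_pos (hr : 0 < r) (hc : 0 < c) (hω : 0 < ω) : 0 < parameter r c ω := by
  rw [← (strictMonoOn_frequency hr hc).lt_iff_lt Set.self_mem_Ici (parameter_nonneg hr hc hω.le),
    frequency_zero, frequency_parameter hr hc hω.le]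
  exact hω

lemma continuousOn_parameter (hr : 0 < r) (hc : 0 < c) :
    ContinuousOn (parameter r c) (Set.Ici 0) := by
  simpa [frequency_zero] using! continuousOn_invFunOn_Ici continuousOn_frequency
    (strictMonoOn_frequency hr hc) (tendsto_frequency hr hc)

lemma hasDerivAt_parameter (hr : 0 < r) (hc : 0 < c) (hω : 0 < ω) :
    HasDerivAt (parameter r c) (frequencyDeriv r c (parameter r c ω))⁻¹ ω := by
  have h := parameter_nonneg hr hc hω.le
  refine HasDerivAt.of_local_left_inverse
    ((continuousOn_parameter hr hc).continuousAt (Ici_mem_nhds hω)) (hasDerivAt_frequency h)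
    (frequencyDeriv_pos hr hc h).ne' ?_
  filter_upwards [Ioi_mem_nhds hω] with x hx using frequency_parameter hr hc (le_of_lt hx)

lemma tendsto_parameter (hr : 0 < r) (hc : 0 < c) :
    Tendsto (parameter r c) (𝓝[>] 0) (𝓝[>] 0) := by
  refine tendsto_nhdsWithin_iff.2 ⟨?_, ?_⟩
  · have := (continuousOn_parameter hr hc 0 Set.self_mem_Ici).tendsto
    rw [parameter_zero hr hc] at this
    exact this.mono_left (nhdsWithin_mono _ Set.Ioi_subset_Ici_self)
  · filter_upwards [self_mem_nhdsWithin] with x hx using parameter_pos hr hc hx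

lemma tendsto_one_add_rpow (s : ℝ) :
    Tendsto (fun x : ℝ => (1 + x) ^ s) (𝓝[>] 0) (𝓝 1) := by
  have := (hasDerivAt_one_add_rpow le_rfl s).continuousAt.tendsto.mono_left
    (nhdsWithin_le_nhds (s := Set.Ioi (0 : ℝ)))
  simpa using this

lemma tendsto_frequencyDeriv :
    Tendsto (frequencyDeriv r c) (𝓝[>] 0) (𝓝 c) := by
  have h0 : Tendsto (fun x : ℝ => x) (𝓝[>] 0) (𝓝 0) := nhdsWithin_le_nhds
  have := ((tendsto_one_add_rpow r⁻¹).add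
    (h0.mul ((tendsto_one_add_rpow (r⁻¹ - 1)).const_mul r⁻¹))).const_mul c
  simpa using! this

end Frequency

/-! ### The branch of ground states, its derivative and its mass -/

lemma exists_isScaling {p q : ℝ} (hp : 1 < p) (hpq : p < q) :
    ∃ r a κ, IsScaling p q 0 r (2 / (p - 1)) 0 a κ := by
  have hp1 : 0 < p - 1 := by linarith
  have hqp : 0 < q - p := by linarith
  have hfrac : 0 < (q + 1) / (p + 1) := by apply div_pos <;> linarith
  set β := 2 / (p - 1) with hβ
  have hβpos : 0 < β := by positivity
  -- Dividing the two amplitude relations at `σ = 0` leaves `a^(q-p) = (β+1+r)/(β+1) = (q+1)/(p+1)`;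
  -- `κ` then follows from the relation for `p`.
  set a := ((q + 1) / (p + 1)) ^ (1 / (q - p)) with ha
  have hapos : 0 < a := by positivity
  have hap : a ^ (q - p) = (q + 1) / (p + 1) := by
    rw [ha, ← Real.rpow_mul hfrac.le, one_div, inv_mul_cancel₀ hqp.ne', Real.rpow_one]
  have hκ : 0 < a ^ (p - 1) / (β * (β + 1)) := by positivity
  refine ⟨(q - p) / (p - 1), a, √(a ^ (p - 1) / (β * (β + 1))), ?_⟩
  constructor
  · positivity
  · exact hβpos
  · exact le_rfl
  · exact hapos
  · exact Real.sqrt_pos.2 hκ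
  · rw [hβ]; field_simp
  · rw [hβ]; field_simp; ring
  · rw [Real.sq_sqrt hκ.le]; field_simp
  · rw [Real.sq_sqrt hκ.le, show q - 1 = (q - p) + (p - 1) by ring, Real.rpow_add hapos, hap]
    have : β * (p - 1) = 2 := by rw [hβ]; field_simp
    have hb1 : β + 1 = (p + 1) / (p - 1) := by rw [hβ]; field_simp; ring
    have hb2 : β + 1 + (q - p) / (p - 1) = (q + 1) / (p - 1) := by rw [hβ]; field_simp; ring
    rw [hb2, hb1]
    field_simp
    simp
  · simp

/-- The ground states, parametrised by `σ` instead of the frequency. -/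
noncomputable def branch (r β a κ σ x : ℝ) : ℝ :=
  a * (1 + σ) ^ (β * (2 * r)⁻¹) * profile r σ |κ * (1 + σ) ^ (2 * r)⁻¹ * x| ^ (-β)

/-- The derivative of `branch r β a κ σ x` in `σ`. -/
noncomputable def branchDeriv (r β a κ σ x : ℝ) : ℝ :=
  let z := profile r σ |κ * (1 + σ) ^ (2 * r)⁻¹ * x|
  a * (β * (2 * r)⁻¹ * (1 + σ) ^ (β * (2 * r)⁻¹ - 1) * z ^ (-β) -
    (1 + σ) ^ (β * (2 * r)⁻¹) * (β * z ^ (-β - 1) * (√(speedSq r σ z) *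
      (κ * ((2 * r)⁻¹ * (1 + σ) ^ ((2 * r)⁻¹ - 1)) * |x| + travelTimeVar r σ z))))

/-- The mass along `branch`. -/
noncomputable def branchMass (r β a κ σ : ℝ) : ℝ :=
  a ^ 2 / κ * ((1 + σ) ^ ((2 * r)⁻¹ * (2 * β - 1)) * massIntegral r (2 * β) σ)

/-- The derivative of `branchMass r β a κ`. -/
noncomputable def branchMassDeriv (r β a κ σ : ℝ) : ℝ :=
  a ^ 2 / κ * ((2 * r)⁻¹ * (2 * β - 1) * (1 + σ) ^ ((2 * r)⁻¹ * (2 * β - 1) - 1) *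
    massIntegral r (2 * β) σ - (1 + σ) ^ ((2 * r)⁻¹ * (2 * β - 1)) * massIntegralVar r (2 * β) σ)

namespace IsScaling

variable {p q r β a κ σ ω x : ℝ}

/-- The exponents are forced: the quotient of the amplitude relations gains a factor `1 + σ`, and `β
(q - p) = 2r`. -/
lemma rescale (h : IsScaling p q 0 r β 0 a κ) (hσ : 0 ≤ σ) :
    IsScaling p q (frequency r (β ^ 2 * κ ^ 2) σ) r β σ (a * (1 + σ) ^ (β * (2 * r)⁻¹))
      (κ * (1 + σ) ^ (2 * r)⁻¹) := by
  have hr := h.r_pos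
  have ha := h.a_pos
  have hκ := h.κ_pos
  have h1 : 0 < 1 + σ := by linarith
  have hsq : ((1 + σ) ^ (2 * r)⁻¹) ^ 2 = (1 + σ) ^ r⁻¹ := by
    rw [← Real.rpow_natCast, ← Real.rpow_mul h1.le]
    congr 1
    push_cast
    field_simp
  constructor
  · exact hr
  · exact h.β_pos
  · exact hσ
  · positivity
  · positivity
  · exact h.mul_p
  · exact h.mul_q
  · rw [Real.mul_rpow ha.le (by positivity), h.amp_p, ← Real.rpow_mul h1.le, mul_pow, hsq,
      show β * (2 * r)⁻¹ * (p - 1) = β * (p - 1) * (2 * r)⁻¹ by ring, h.mul_p,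
      show 2 * (2 * r)⁻¹ = r⁻¹ by field_simp]
    ring
  · rw [Real.mul_rpow ha.le (by positivity), h.amp_q, ← Real.rpow_mul h1.le, mul_pow, hsq,
      show β * (2 * r)⁻¹ * (q - 1) = β * (q - 1) * (2 * r)⁻¹ by ring, h.mul_q,
      show (2 * r + 2) * (2 * r)⁻¹ = 1 + r⁻¹ by field_simp, Real.rpow_add h1, Real.rpow_one]
    ring
  · rw [mul_pow, hsq, frequency]
    ring

lemma coeff_pos (h : IsScaling p q 0 r β 0 a κ) : 0 < β ^ 2 * κ ^ 2 := by
  have := h.β_pos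
  have := h.κ_pos
  positivity

lemma rescale_parameter (h : IsScaling p q 0 r β 0 a κ) (hω : 0 ≤ ω) :
    IsScaling p q ω r β (parameter r (β ^ 2 * κ ^ 2) ω)
      (a * (1 + parameter r (β ^ 2 * κ ^ 2) ω) ^ (β * (2 * r)⁻¹))
      (κ * (1 + parameter r (β ^ 2 * κ ^ 2) ω) ^ (2 * r)⁻¹) := by
  have := h.rescale (parameter_nonneg h.r_pos h.coeff_pos hω)
  rwa [frequency_parameter h.r_pos h.coeff_pos hω] at this

lemma groundState_eq_branch (h : IsScaling p q 0 r β 0 a κ) (hω : 0 ≤ ω) :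
    groundState p q ω = branch r β a κ (parameter r (β ^ 2 * κ ^ 2) ω) :=
  (h.rescale_parameter hω).groundState_eq

lemma hasDerivAt_branch (h : IsScaling p q 0 r β 0 a κ) (hσ : 0 < σ) :
    HasDerivAt (fun s => branch r β a κ s x) (branchDeriv r β a κ σ x) σ := by
  have hr := h.r_pos
  have hκ := h.κ_pos
  have hz : HasDerivAt (fun s => profile r s |κ * (1 + s) ^ (2 * r)⁻¹ * x|)
      (√(speedSq r σ (profile r σ |κ * (1 + σ) ^ (2 * r)⁻¹ * x|)) *
        (κ * ((2 * r)⁻¹ * (1 + σ) ^ ((2 * r)⁻¹ - 1)) * |x| +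
          travelTimeVar r σ (profile r σ |κ * (1 + σ) ^ (2 * r)⁻¹ * x|))) σ := by
    have hy : ∀ s, 0 < s → |κ * (1 + s) ^ (2 * r)⁻¹ * x| = κ * (1 + s) ^ (2 * r)⁻¹ * |x| := by
      intro s hs
      rw [abs_mul, abs_of_pos (by positivity)]
    -- Implicit differentiation needs positive time. At `x = 0` the height is constantly `1`, and
    -- the proposed derivative vanishes with the speed.
    rcases eq_or_ne x 0 with rfl | hx
    · simp only [mul_zero, abs_zero, profile_zero hr hσ.le, speedSq_one, Real.sqrt_zero, zero_mul]
      refine (hasDerivAt_const σ (1 : ℝ)).congr_of_eventuallyEq ?_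
      filter_upwards [Ioi_mem_nhds hσ] with s hs using profile_zero hr (le_of_lt hs)
    · have hd : HasDerivAt (fun s => |κ * (1 + s) ^ (2 * r)⁻¹ * x|)
          (κ * ((2 * r)⁻¹ * (1 + σ) ^ ((2 * r)⁻¹ - 1)) * |x|) σ := by
        refine (((hasDerivAt_one_add_rpow hσ.le (2 * r)⁻¹).const_mul κ).mul_const
          |x|).congr_of_eventuallyEq ?_
        filter_upwards [Ioi_mem_nhds hσ] with s hs using hy s hs
      exact hasDerivAt_profile_comp hr hσ hd (by positivity)
  have hpos : 0 < profile r σ |κ * (1 + σ) ^ (2 * r)⁻¹ * x| :=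
    one_pos.trans_le (one_le_profile_abs hr hσ.le _)
  refine ((((hasDerivAt_one_add_rpow hσ.le (β * (2 * r)⁻¹)).const_mul a)).fun_mul
    (hz.rpow_const (p := -β) (Or.inl hpos.ne'))).congr_deriv ?_
  unfold branchDeriv
  ring

lemma tendsto_branchDeriv (h : IsScaling p q 0 r β 0 a κ) :
    Tendsto (fun s => branchDeriv r β a κ s x) (𝓝[>] 0) (𝓝 (branchDeriv r β a κ 0 x)) := by
  have hr := h.r_pos
  have h0 : Tendsto (fun s : ℝ => s) (𝓝[>] 0) (𝓝 0) := nhdsWithin_le_nhds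
  have hev : ∀ᶠ s : ℝ in 𝓝[>] 0, 0 ≤ s := by
    filter_upwards [self_mem_nhdsWithin] with s hs using le_of_lt hs
  have hy : Tendsto (fun s => |κ * (1 + s) ^ (2 * r)⁻¹ * x|) (𝓝[>] 0)
      (𝓝 |κ * (1 + 0) ^ (2 * r)⁻¹ * x|) := by
    have := (((tendsto_one_add_rpow (2 * r)⁻¹).const_mul κ).mul_const x).abs
    simpa using this
  have hz := tendsto_profile hr h0 hev le_rfl hy (Eventually.of_forall fun s => abs_nonneg _)
    (abs_nonneg _)
  have hz1 : 1 ≤ profile r 0 |κ * (1 + 0) ^ (2 * r)⁻¹ * x| := one_le_profile_abs hr le_rfl _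
  have hz0 : profile r 0 |κ * (1 + 0) ^ (2 * r)⁻¹ * x| ≠ 0 := by linarith
  have hP := tendsto_travelTimeVar_comp hr h0 hev le_rfl hz1 hz
    (hev.mono fun s hs => one_le_profile_abs hr hs _)
  have hw := fun s : ℝ => hz.rpow_const (p := s) (Or.inl hz0)
  have hD := ((h0.mul ((hz.pow 2).sub (hw (-(2 * r))))).add ((hw (-(2 * r))).const_sub 1)).sqrt
  have := (((((tendsto_one_add_rpow (β * (2 * r)⁻¹ - 1)).const_mul (β * (2 * r)⁻¹)).mul
    (hw (-β))).sub ((tendsto_one_add_rpow (β * (2 * r)⁻¹)).mul (((hw (-β - 1)).const_mul β).mul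
      (hD.mul ((((((tendsto_one_add_rpow ((2 * r)⁻¹ - 1)).const_mul (2 * r)⁻¹).const_mul
        κ).mul_const |x|).add hP)))))).const_mul a)
  simp only [branchDeriv, speedSq]
  simpa using this

lemma eta_eq (h : IsScaling p q 0 r β 0 a κ) (hω : 0 < ω) :
    HasDerivAt (fun w => groundState p q w x)
      (branchDeriv r β a κ (parameter r (β ^ 2 * κ ^ 2) ω) x *
        (frequencyDeriv r (β ^ 2 * κ ^ 2) (parameter r (β ^ 2 * κ ^ 2) ω))⁻¹) ω := by
  refine ((h.hasDerivAt_branch (parameter_pos h.r_pos h.coeff_pos hω)).comp ω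
    (hasDerivAt_parameter h.r_pos h.coeff_pos hω)).congr_of_eventuallyEq ?_
  filter_upwards [Ioi_mem_nhds hω] with w hw
  rw [h.groundState_eq_branch (le_of_lt hw)]
  rfl

lemma tendsto_eta (h : IsScaling p q 0 r β 0 a κ) :
    Tendsto (fun ω => eta p q ω x) (𝓝[>] 0)
      (𝓝 (branchDeriv r β a κ 0 x * (β ^ 2 * κ ^ 2)⁻¹)) := by
  have hp := tendsto_parameter h.r_pos h.coeff_pos
  have h1 := ((h.tendsto_branchDeriv (x := x)).comp hp).mul
    (((tendsto_frequencyDeriv (r := r)).comp hp).inv₀ h.coeff_pos.ne')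
  refine h1.congr' ?_
  filter_upwards [self_mem_nhdsWithin] with ω hω using (h.eta_eq hω).deriv.symm

lemma etaZero_eq (h : IsScaling p q 0 r β 0 a κ) :
    etaZero p q x = branchDeriv r β a κ 0 x * (β ^ 2 * κ ^ 2)⁻¹ :=
  h.tendsto_eta.limUnder_eq

lemma sq_mul_rpow_mul (A s : ℝ) {z : ℝ} (hz : 0 < z) :
    (A * z ^ (-β)) ^ 2 * s = A ^ 2 * (z ^ (-(2 * β)) * s) := by
  rw [mul_pow, ← Real.rpow_natCast (z ^ (-β)), ← Real.rpow_mul hz.le]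
  push_cast
  ring_nf

lemma integrable_branch_sq (h : IsScaling p q 0 r β 0 a κ) (hσ : 0 < σ) :
    Integrable fun x => branch r β a κ σ x ^ 2 := by
  have hr := h.r_pos
  have hκ := h.κ_pos
  have hβ := h.β_pos
  unfold branch
  rw [integrable_comp_profile_abs_iff hr hσ.le (by positivity)
    (fun z => (a * (1 + σ) ^ (β * (2 * r)⁻¹) * z ^ (-β)) ^ 2)]
  refine (integrableOn_congr_fun (fun z hz => sq_mul_rpow_mul _ _ (one_pos.trans hz))
    measurableSet_Ioi).2 ?_
  exact (integrableOn_rpow_mul_slowness hr hσ (by positivity)).const_mul _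

lemma half_integral_branch_sq (h : IsScaling p q 0 r β 0 a κ) (hσ : 0 ≤ σ) :
    1 / 2 * ∫ x, branch r β a κ σ x ^ 2 = branchMass r β a κ σ := by
  have hr := h.r_pos
  have hκ := h.κ_pos
  have h1 : 0 < 1 + σ := by linarith
  unfold branch
  rw [integral_comp_profile_abs hr hσ (by positivity)
    (fun z => (a * (1 + σ) ^ (β * (2 * r)⁻¹) * z ^ (-β)) ^ 2),
    setIntegral_congr_fun measurableSet_Ioi
      (fun z hz => sq_mul_rpow_mul _ _ (one_pos.trans hz)), integral_const_mul, ← massIntegral,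
    branchMass, mul_sub, Real.rpow_sub h1, mul_one,
    show (2 * r)⁻¹ * (2 * β) = β * (2 * r)⁻¹ + β * (2 * r)⁻¹ by ring, Real.rpow_add h1]
  field_simp

lemma mass_eq (h : IsScaling p q 0 r β 0 a κ) (hω : 0 ≤ ω) :
    mass p q ω = branchMass r β a κ (parameter r (β ^ 2 * κ ^ 2) ω) := by
  rw [mass, h.groundState_eq_branch hω,
    h.half_integral_branch_sq (parameter_nonneg h.r_pos h.coeff_pos hω)]

lemma hasDerivAt_branchMass (h : IsScaling p q 0 r β 0 a κ) (hσ : 0 < σ) :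
    HasDerivAt (branchMass r β a κ) (branchMassDeriv r β a κ σ) σ := by
  have := h.β_pos
  refine (((hasDerivAt_one_add_rpow hσ.le ((2 * r)⁻¹ * (2 * β - 1))).fun_mul
    (hasDerivAt_massIntegral (m := 2 * β) h.r_pos (by positivity) hσ)).const_mul
      (a ^ 2 / κ)).congr_deriv ?_
  unfold branchMassDeriv
  ring

lemma hasDerivAt_mass (h : IsScaling p q 0 r β 0 a κ) (hω : 0 < ω) :
    HasDerivAt (mass p q) (branchMassDeriv r β a κ (parameter r (β ^ 2 * κ ^ 2) ω) *
        (frequencyDeriv r (β ^ 2 * κ ^ 2) (parameter r (β ^ 2 * κ ^ 2) ω))⁻¹) ω := by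
  refine ((h.hasDerivAt_branchMass (parameter_pos h.r_pos h.coeff_pos hω)).comp ω
    (hasDerivAt_parameter h.r_pos h.coeff_pos hω)).congr_of_eventuallyEq ?_
  filter_upwards [Ioi_mem_nhds hω] with w hw using h.mass_eq (le_of_lt hw)

lemma tendsto_deriv_mass_of_three_lt (h : IsScaling p q 0 r β 0 a κ) (hβ3 : 3 < 2 * β) :
    Tendsto (deriv (mass p q)) (𝓝[>] 0)
      (𝓝 (a ^ 2 / κ * ((2 * r)⁻¹ * (2 * β - 1) * massIntegral r (2 * β) 0 -
        massIntegralVar r (2 * β) 0) * (β ^ 2 * κ ^ 2)⁻¹)) := by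
  have hp := tendsto_parameter h.r_pos h.coeff_pos
  have h1 : Tendsto (branchMassDeriv r β a κ) (𝓝[>] 0)
      (𝓝 (a ^ 2 / κ * ((2 * r)⁻¹ * (2 * β - 1) * massIntegral r (2 * β) 0 -
        massIntegralVar r (2 * β) 0))) := by
    have := ((((tendsto_one_add_rpow ((2 * r)⁻¹ * (2 * β - 1) - 1)).const_mul
      ((2 * r)⁻¹ * (2 * β - 1))).mul (tendsto_massIntegral (m := 2 * β) h.r_pos
        (by linarith))).sub ((tendsto_one_add_rpow ((2 * r)⁻¹ * (2 * β - 1))).mul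
          (tendsto_massIntegralVar h.r_pos hβ3))).const_mul (a ^ 2 / κ)
    rw [mul_one, one_mul] at this
    exact this
  refine ((h1.comp hp).mul (((tendsto_frequencyDeriv (r := r)).comp hp).inv₀ h.coeff_pos.ne')).congr' ?_
  filter_upwards [self_mem_nhdsWithin] with ω hω using (h.hasDerivAt_mass hω).deriv.symm

lemma tendsto_deriv_mass_of_le_three (h : IsScaling p q 0 r β 0 a κ) (hβ3 : 2 * β ≤ 3) :
    Tendsto (deriv (mass p q)) (𝓝[>] 0) atBot := by
  have hβ := h.β_pos
  have hr := h.r_pos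
  have ha := h.a_pos
  have hκ := h.κ_pos
  have hp := tendsto_parameter h.r_pos h.coeff_pos
  -- Only an upper bound is needed for the term containing `massIntegral`. For `2β ≤ 1` its
  -- coefficient is nonpositive, so convergence of the integral as `σ ↓ 0` is not needed; for `2β >
  -- 1` the term converges.
  have hN : ∃ C, ∀ᶠ s in 𝓝[>] 0, (2 * r)⁻¹ * (2 * β - 1) *
      (1 + s) ^ ((2 * r)⁻¹ * (2 * β - 1) - 1) * massIntegral r (2 * β) s ≤ C := by
    rcases le_or_gt (2 * β) 1 with h1 | h1
    · refine ⟨0, ?_⟩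
      filter_upwards [self_mem_nhdsWithin] with s hs
      have hs : 0 < s := hs
      refine mul_nonpos_of_nonpos_of_nonneg (mul_nonpos_of_nonpos_of_nonneg
        (mul_nonpos_of_nonneg_of_nonpos (by positivity) (by linarith)) (by positivity))
        massIntegral_nonneg
    · have := ((tendsto_one_add_rpow ((2 * r)⁻¹ * (2 * β - 1) - 1)).const_mul
        ((2 * r)⁻¹ * (2 * β - 1))).mul (tendsto_massIntegral (m := 2 * β) h.r_pos h1)
      exact ⟨_, this.eventually_le_const (lt_add_one _)⟩
  obtain ⟨C, hC⟩ := hN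
  have hNv : Tendsto (fun s => (1 + s) ^ ((2 * r)⁻¹ * (2 * β - 1)) *
      massIntegralVar r (2 * β) s) (𝓝[>] 0) atTop :=
    (tendsto_one_add_rpow _).pos_mul_atTop one_pos
      (tendsto_massIntegralVar_atTop hr (by positivity) hβ3)
  have h1 : Tendsto (branchMassDeriv r β a κ) (𝓝[>] 0) atBot := by
    refine Tendsto.const_mul_atBot (by positivity) ?_
    have := tendsto_atBot_add_left_of_ge' _ C hC (tendsto_neg_atTop_atBot.comp hNv)
    simpa [sub_eq_add_neg] using! this
  refine ((h1.comp hp).atBot_mul_pos (inv_pos.2 h.coeff_pos)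
    (((tendsto_frequencyDeriv (r := r)).comp hp).inv₀ h.coeff_pos.ne')).congr' ?_
  filter_upwards [self_mem_nhdsWithin] with ω hω using (h.hasDerivAt_mass hω).deriv.symm

end IsScaling

/-! ### The integral of `φ_0 η_0` in the height variable -/

/-- Up to a constant factor, the product `φ₀ η₀` as a function of the normalised height. -/
noncomputable def limitIntegrand (r m z : ℝ) : ℝ :=
  (2 * r)⁻¹ * z ^ (-m) - z ^ (-m - 1) *
    (√(speedSq r 0 z) * ((2 * r)⁻¹ * travelTime r 0 z + travelTimeVar r 0 z))

section LimitIntegrand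

variable {r m z : ℝ}

lemma sqrt_speedSq_mul_slowness (hr : 0 < r) {σ : ℝ} (hσ : 0 ≤ σ) (hz : 1 < z) :
    √(speedSq r σ z) * slowness r σ z = 1 :=
  mul_inv_cancel₀ (Real.sqrt_pos.2 (speedSq_pos hr hσ hz)).ne'

/-- The speed increases with height, so the climb to `z` takes at least as long as it would at the
final speed. -/
lemma sub_one_le_sqrt_speedSq_mul_travelTime (hr : 0 < r) (hz : 1 ≤ z) :
    z - 1 ≤ √(speedSq r 0 z) * travelTime r 0 z := by
  rcases hz.eq_or_lt with rfl | hz1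
  · simp
  have hle : (z - 1) * slowness r 0 z ≤ travelTime r 0 z := by
    have : (z - 1) * slowness r 0 z = ∫ _ in (1 : ℝ)..z, slowness r 0 z := by simp
    rw [this]
    refine intervalIntegral.integral_mono_on_of_le_Ioo hz intervalIntegrable_const
      (intervalIntegrable_slowness hr le_rfl le_rfl hz) fun t ht => ?_
    have h1 := speedSq_pos hr le_rfl ht.1
    exact inv_anti₀ (Real.sqrt_pos.2 h1) (Real.sqrt_le_sqrt
      ((speedSq_strictMonoOn hr le_rfl).monotoneOn (Set.mem_Ioi.2 (one_pos.trans ht.1))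
        (Set.mem_Ioi.2 (one_pos.trans hz1)) ht.2.le))
  calc z - 1 = √(speedSq r 0 z) * ((z - 1) * slowness r 0 z) := by
        rw [mul_left_comm, sqrt_speedSq_mul_slowness hr le_rfl hz1, mul_one]
    _ ≤ _ := by gcongr

/-- The positive term `z^(-m)` need not be integrable against the slowness when `m ≤ 1`. The
travel-time term cancels it up to `z^(-m-1)`, which is integrable against the slowness for every `m
> 0`. -/
lemma limitIntegrand_le (hr : 0 < r) (hz : 1 ≤ z) :
    limitIntegrand r m z ≤ (2 * r)⁻¹ * z ^ (-m - 1) -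
      z ^ (-m - 1) * (√(speedSq r 0 z) * travelTimeVar r 0 z) := by
  have hz0 : 0 < z := by linarith
  have h1 := mul_le_mul_of_nonneg_left (sub_one_le_sqrt_speedSq_mul_travelTime hr hz)
    (show 0 ≤ (2 * r)⁻¹ * z ^ (-m - 1) by positivity)
  have h2 : z ^ (-m) = z ^ (-m - 1) * z := by
    rw [Real.rpow_sub_one hz0.ne']; field_simp
  rw [limitIntegrand, h2]
  linarith

lemma limitIntegrand_mul_slowness (hr : 0 < r) (hz : 1 < z) :
    limitIntegrand r m z * slowness r 0 z = (2 * r)⁻¹ * (z ^ (-m) * slowness r 0 z) -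
      ((2 * r)⁻¹ * (z ^ (-m - 1) * ∫ t in (1 : ℝ)..z, slowness r 0 t) +
        z ^ (-m - 1) * ∫ t in (1 : ℝ)..z, slownessVar r 0 t) := by
  have h := sqrt_speedSq_mul_slowness hr le_rfl hz
  rw [← travelTime, ← travelTimeVar, limitIntegrand]
  linear_combination (-(z ^ (-m - 1) * ((2 * r)⁻¹ * travelTime r 0 z + travelTimeVar r 0 z))) * h

lemma integrableOn_rpow_mul_primitive_slowness_iff (hr : 0 < r) (hm : 0 < m) :
    IntegrableOn (fun z : ℝ => z ^ (-m - 1) * ∫ t in (1 : ℝ)..z, slowness r 0 t) (Set.Ioi 1) ↔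
      IntegrableOn (fun t => t ^ (-m) * slowness r 0 t) (Set.Ioi 1) :=
  integrableOn_rpow_mul_primitive_iff hm (by fun_prop) (fun _ _ => slowness_nonneg)
    fun _ hz => intervalIntegrable_slowness hr le_rfl le_rfl hz

lemma integrableOn_rpow_mul_primitive_slownessVar_iff (hr : 0 < r) (hm : 0 < m) :
    IntegrableOn (fun z : ℝ => z ^ (-m - 1) * ∫ t in (1 : ℝ)..z, slownessVar r 0 t) (Set.Ioi 1) ↔
      IntegrableOn (fun t => t ^ (-m) * slownessVar r 0 t) (Set.Ioi 1) :=
  integrableOn_rpow_mul_primitive_iff hm (by fun_prop)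
    (fun _ ht => slownessVar_nonneg hr (le_of_lt ht))
    fun _ hz => intervalIntegrable_slownessVar hr le_rfl le_rfl hz

/-- By Tonelli the travel-time term contributes `-m⁻¹` times the first integral. This turns the
coefficient `1` into `(m-1)/m` and reproduces the derivative of the mass at `σ = 0` up to a
constant. -/
lemma integrableOn_limitIntegrand_mul_slowness (hr : 0 < r) (hm : 3 < m) :
    IntegrableOn (fun z => limitIntegrand r m z * slowness r 0 z) (Set.Ioi 1) ∧
      ∫ z in Set.Ioi 1, limitIntegrand r m z * slowness r 0 z =
        m⁻¹ * ((2 * r)⁻¹ * (m - 1) * massIntegral r m 0 - massIntegralVar r m 0) := by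
  have hm0 : 0 < m := by linarith
  have h1 := integrableOn_rpow_mul_slowness_zero hr (s := m) (by linarith)
  have h2 := (integrableOn_rpow_mul_slownessVar hr hm le_rfl).1
  have h3 := (integrableOn_rpow_mul_primitive_slowness_iff hr hm0).2 h1
  have h4 := (integrableOn_rpow_mul_primitive_slownessVar_iff hr hm0).2 h2
  have h5 := h3.const_mul (2 * r)⁻¹
  have h6 : IntegrableOn (fun z => (2 * r)⁻¹ * (z ^ (-m - 1) * ∫ t in (1 : ℝ)..z, slowness r 0 t) +
      z ^ (-m - 1) * ∫ t in (1 : ℝ)..z, slownessVar r 0 t) (Set.Ioi 1) := h5.add h4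
  have hcongr : Set.EqOn _ _ (Set.Ioi (1 : ℝ)) := fun z hz =>
    limitIntegrand_mul_slowness (m := m) hr hz
  refine ⟨(integrableOn_congr_fun hcongr measurableSet_Ioi).2
    ((h1.const_mul _).sub h6), ?_⟩
  rw [setIntegral_congr_fun measurableSet_Ioi hcongr, integral_sub (h1.const_mul _) h6,
    integral_add h5 h4, integral_const_mul, integral_const_mul,
    integral_rpow_mul_primitive hm0 (by fun_prop) (fun _ _ => slowness_nonneg)
      fun _ hz => intervalIntegrable_slowness hr le_rfl le_rfl hz,
    integral_rpow_mul_primitive hm0 (by fun_prop)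
      (fun _ ht => slownessVar_nonneg hr (le_of_lt ht))
      fun _ hz => intervalIntegrable_slownessVar hr le_rfl le_rfl hz,
    ← massIntegral, ← massIntegralVar]
  field_simp
  ring

lemma continuousOn_rpow_const_Ici (s : ℝ) : ContinuousOn (fun z : ℝ => z ^ s) (Set.Ici 1) :=
  fun z hz => (Real.continuousAt_rpow_const z s
    (Or.inl (one_pos.trans_le hz).ne')).continuousWithinAt

lemma continuousOn_sqrt_speedSq : ContinuousOn (fun z => √(speedSq r 0 z)) (Set.Ici 1) :=
  (continuousOn_speedSq.mono (Set.Ici_subset_Ioi.2 one_pos)).sqrt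

lemma continuousOn_limitIntegrand (hr : 0 < r) :
    ContinuousOn (limitIntegrand r m) (Set.Ici 1) :=
  ((continuousOn_rpow_const_Ici _).const_mul _).sub ((continuousOn_rpow_const_Ici _).mul
    (continuousOn_sqrt_speedSq.mul (((continuousOn_travelTime hr le_rfl).const_mul _).add
      (continuousOn_travelTimeVar hr le_rfl))))

lemma integralEqNegInfinity_limitIntegrand (hr : 0 < r) (hm0 : 0 < m) (hm : m ≤ 3) {C κ : ℝ}
    (hC : 0 < C) (hκ : 0 < κ) :
    IntegralEqNegInfinity fun x => C * limitIntegrand r m (profile r 0 |κ * x|) := by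
  have hV : ∀ x, 1 ≤ profile r 0 |κ * x| := fun x => one_le_profile_abs hr le_rfl _
  have hVc : Continuous fun x => profile r 0 |κ * x| :=
    (continuous_profile_abs hr le_rfl).comp (continuous_const_mul κ)
  set B : ℝ → ℝ := fun x => C * ((2 * r)⁻¹ * profile r 0 |κ * x| ^ (-m - 1)) with hB
  have hBint : Integrable B := by
    refine (integrable_comp_profile_abs_iff hr le_rfl hκ
      (fun z => C * ((2 * r)⁻¹ * z ^ (-m - 1)))).2 ?_
    have := (integrableOn_rpow_mul_slowness_zero hr (s := m + 1) (by linarith)).const_mul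
      (C * (2 * r)⁻¹)
    refine (integrableOn_congr_fun (fun z _ => ?_) measurableSet_Ioi).1 this
    rw [neg_add, ← sub_eq_add_neg]
    ring
  have hBfin := hBint.lintegral_lt_top
  set v : ℝ → ℝ := fun z => z ^ (-m - 1) * (√(speedSq r 0 z) * travelTimeVar r 0 z) with hv
  have hv0 : ∀ z, 1 ≤ z → 0 ≤ v z := fun z hz => by
    have := travelTimeVar_nonneg (σ := 0) hr hz
    have : 0 < z := by linarith
    positivity
  have hvc : ContinuousOn v (Set.Ici 1) := (continuousOn_rpow_const_Ici _).mul
    (continuousOn_sqrt_speedSq.mul (continuousOn_travelTimeVar hr le_rfl))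
  have hle : ∀ x, C * limitIntegrand r m (profile r 0 |κ * x|) ≤
      B x - C * v (profile r 0 |κ * x|) := fun x => by
    have := mul_le_mul_of_nonneg_left (limitIntegrand_le (m := m) hr (hV x)) hC.le
    rw [mul_sub] at this
    exact this
  have hvnn : ∀ x, 0 ≤ C * v (profile r 0 |κ * x|) := fun x => mul_nonneg hC.le (hv0 _ (hV x))
  refine ⟨?_, ?_, ?_⟩
  · exact (continuous_const.mul
      ((continuousOn_limitIntegrand hr).comp_continuous hVc hV)).aestronglyMeasurable
  · refine (lintegral_mono fun x => ENNReal.ofReal_le_ofReal ?_).trans_lt hBfin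
    linarith [hle x, hvnn x]
  · by_contra hfin
    -- If the negative part were finite, `C v ≤ B + (negative part)` would make `v` integrable along
    -- the profile; by Tonelli `t^(-m) slownessVar` would then be integrable at `σ = 0`, which fails
    -- for `m ≤ 3`.
    have hsum : ∫⁻ x, ENNReal.ofReal (C * v (profile r 0 |κ * x|)) ≠ ⊤ := by
      refine ((lintegral_mono (g := fun x => ENNReal.ofReal (B x) + ENNReal.ofReal
        (-(C * limitIntegrand r m (profile r 0 |κ * x|)))) fun x => ?_).trans_lt ?_).ne
      · refine (ENNReal.ofReal_le_ofReal ?_).trans ENNReal.ofReal_add_le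
        linarith [hle x]
      · rw [lintegral_add_left' hBint.1.aemeasurable.ennreal_ofReal]
        exact ENNReal.add_lt_top.2 ⟨hBfin, Ne.lt_top hfin⟩
    have hint : Integrable fun x => C * v (profile r 0 |κ * x|) :=
      (lintegral_ofReal_ne_top_iff_integrable
        (continuous_const.mul (hvc.comp_continuous hVc hV)).aestronglyMeasurable
        (Eventually.of_forall hvnn)).1 hsum
    rw [integrable_const_mul_iff (by simpa using hC.ne'),
      integrable_comp_profile_abs_iff hr le_rfl hκ] at hint
    refine not_integrableOn_rpow_mul_slownessVar_zero hr hm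
      ((integrableOn_rpow_mul_primitive_slownessVar_iff hr hm0).1
        ((integrableOn_congr_fun (fun z hz => ?_) measurableSet_Ioi).1 hint))
    have h := sqrt_speedSq_mul_slowness hr le_rfl hz
    rw [← travelTimeVar]
    linear_combination (z ^ (-m - 1) * travelTimeVar r 0 z) * h

end LimitIntegrand

namespace IsScaling

variable {p q r β a κ : ℝ}

lemma groundState_mul_etaZero (h : IsScaling p q 0 r β 0 a κ) :
    (fun x => groundState p q 0 x * etaZero p q x) = fun x =>
      a ^ 2 * β * (β ^ 2 * κ ^ 2)⁻¹ * limitIntegrand r (2 * β) (profile r 0 |κ * x|) := by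
  funext x
  have hr := h.r_pos
  rw [h.etaZero_eq, h.groundState_eq_branch le_rfl, parameter_zero hr h.coeff_pos, branch,
    branchDeriv, limitIntegrand]
  simp only [add_zero, Real.one_rpow, mul_one]
  -- The explicit factor `|x|`, from differentiating the length scale, is itself a travel time;
  -- hence the product depends on `x` only through the height.
  have hT : κ * |x| = travelTime r 0 (profile r 0 |κ * x|) := by
    rw [travelTime_profile hr le_rfl (abs_nonneg _), abs_mul, abs_of_pos h.κ_pos]
  rw [show κ * (2 * r)⁻¹ * |x| = (2 * r)⁻¹ * (κ * |x|) by ring, hT]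
  have hz : 0 < profile r 0 |κ * x| := one_pos.trans_le (one_le_profile_abs hr le_rfl _)
  set z := profile r 0 |κ * x|
  rw [Real.rpow_sub_one hz.ne', Real.rpow_sub_one hz.ne',
    show -(2 * β) = -β + -β by ring, Real.rpow_add hz]
  ring

end IsScaling

end DoublePower

theorem theorem3p1 (p q : ℝ) (hp : 1 < p) (hpq : p < q) :
    -- the objects in the claim are well defined
    (∀ ω : ℝ, 0 ≤ ω → ∃! φ : ℝ → ℝ, DoublePower.IsGroundState p q ω φ) ∧
    (∀ ω : ℝ, 0 < ω →
      MemLp (DoublePower.groundState p q ω) 2 volume ∧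
      DifferentiableAt ℝ (DoublePower.mass p q) ω ∧
      ∀ x : ℝ, DifferentiableAt ℝ (fun w : ℝ => DoublePower.groundState p q w x) ω) ∧
    (∀ x : ℝ, Tendsto (fun ω : ℝ => DoublePower.eta p q ω x) (𝓝[>] (0 : ℝ))
      (𝓝 (DoublePower.etaZero p q x))) ∧
    -- the case `p < 7/3`
    (p < 7 / 3 →
      Integrable (fun x : ℝ => DoublePower.groundState p q 0 x * DoublePower.etaZero p q x)
        volume ∧
      Tendsto (deriv (DoublePower.mass p q)) (𝓝[>] (0 : ℝ))
        (𝓝 (∫ x : ℝ, DoublePower.groundState p q 0 x * DoublePower.etaZero p q x))) ∧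
    -- the case `p ≥ 7/3`
    (7 / 3 ≤ p →
      Tendsto (deriv (DoublePower.mass p q)) (𝓝[>] (0 : ℝ)) atBot ∧
      DoublePower.IntegralEqNegInfinity
        (fun x : ℝ => DoublePower.groundState p q 0 x * DoublePower.etaZero p q x)) := by
  obtain ⟨r, a, κ, h⟩ := DoublePower.exists_isScaling hp hpq
  have hp1 : 0 < p - 1 := by linarith
  have hr := h.r_pos
  have ha := h.a_pos
  have hκ := h.κ_pos
  have hβ := h.β_pos
  have hc := h.coeff_pos
  refine ⟨fun ω hω => (h.rescale_parameter hω).existsUnique, fun ω hω => ⟨?_, ?_, fun x => ?_⟩,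
    fun x => ?_, fun hp3 => ?_, fun hp3 => ?_⟩
  · have hg := (h.rescale_parameter hω.le).isGroundState
    rw [← (h.rescale_parameter hω.le).groundState_eq] at hg
    rw [memLp_two_iff_integrable_sq hg.contDiff.continuous.aestronglyMeasurable,
      h.groundState_eq_branch hω.le]
    exact h.integrable_branch_sq (DoublePower.parameter_pos hr hc hω)
  · exact (h.hasDerivAt_mass hω).differentiableAt
  · exact (h.eta_eq hω).differentiableAt
  · rw [h.etaZero_eq]
    exact h.tendsto_eta
  · have hβ3 : 3 < 2 * (2 / (p - 1)) := by
      rw [← mul_div_assoc, lt_div_iff₀ hp1]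
      linarith
    obtain ⟨h1, h2⟩ := DoublePower.integrableOn_limitIntegrand_mul_slowness hr hβ3
    rw [h.groundState_mul_etaZero]
    refine ⟨((DoublePower.integrable_comp_profile_abs_iff hr le_rfl hκ _).2 h1).const_mul _, ?_⟩
    rw [integral_const_mul, DoublePower.integral_comp_profile_abs hr le_rfl hκ, h2]
    -- The constants agree because `a² β · (2/κ) · (2β)⁻¹ = a²/κ`.
    convert h.tendsto_deriv_mass_of_three_lt hβ3 using 2
    generalize 2 / (p - 1) = β at *
    field_simp
  · have hβ3 : 2 * (2 / (p - 1)) ≤ 3 := by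
      rw [← mul_div_assoc, div_le_iff₀ hp1]
      linarith
    refine ⟨h.tendsto_deriv_mass_of_le_three hβ3, ?_⟩
    rw [h.groundState_mul_etaZero]
    exact DoublePower.integralEqNegInfinity_limitIntegrand hr (by positivity) hβ3
      (by positivity) hκ
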